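/- **Setting.** Let $\mathcal X$ be a set, $z_1,\dots,z_m\in\mathcal X$ (support points), $h:\mathcal X^T\to\mathbb R$, $g:\mathcal X^S\to\mathbb R$, and let $y_1,\dots,y_n\in\mathbb R$ be data with empirical distribution function $\hat F_Y$. Let $q\in\mathbb R$ (in applications, a Kolmogorov–Smirnov critical value). For a weight vector $p=(p_1,\dots,p_m)$ let $E_p$ denote expectation when the coordinates of $\mathbf X$ are i.i.d. and take the value $z_i$ with probability $p_i$. Put $\psi(p)=E_p[g(\mathbf X)]$ ($\mathbf X$ of length $S$), $F_j(p)=E_p[I(h(\mathbf X)\le y_j)]$ ($\mathbf X$ of length $T$), let $\Pi_j$ be the projection onto $[\hat F_Y(y_j+)-q/\sqrt n,\ \hat F_Y(y_j-)+q/\sqrt n]$, where $\hat F_Y(y_j\pm)$ are the one-sided limits, and $W(p)=\sum_{j=1}^n(F_j(p)-\Pi_j(F_j(p)))^2$. For $0<\varepsilon<1/m$ let $\mathcal P(\varepsilon)=\{p:\sum_ip_i=1,\ p_i\ge\varepsilon\ \forall i\}$. Call $p\in\mathcal P(\varepsilon)$ feasible if $\hat F_Y(y_j+)-q/\sqrt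 n\le F_j(p)\le\hat F_Y(y_j-)+q/\sqrt n$ for all $j$, and infeasible otherwise. Let $\Psi(p),\phi(p)\in\mathbb R^m$ be the Gateaux derivatives $\Psi_i(p)=\frac{d}{dt}\psi((1-t)p+t\mathbf 1_i)|_{t=0^+}$ and $\phi_i(p)=\frac{d}{dt}W((1-t)p+t\mathbf 1_i)|_{t=0^+}$. **Assumptions.** 1. $\psi$ has a unique minimizer $p^*_\varepsilon$ over the feasible set; $\Psi(p)'(p-p^*_\varepsilon)>0$ for every feasible $p\ne p^*_\varepsilon$, and $\phi(p)'(p-p^*_\varepsilon)>0$ for every infeasible $p\in\mathcal P(\varepsilon)$. 2. There is $\lambda_\varepsilon>0$ such that for every $\lambda\in(0,\lambda_\varepsilon]$ the function $\lambda\psi+W$ has a unique minimizer $p^*_\varepsilon(\lambda)$ over $\mathcal P(\varepsilon)$, with $(\lambda\Psi(p)+\phi(p))'(p-p^*_\varepsilon(\lambda))\ge0$ for all $p\in\mathcal P(\varepsilon)$; and $\lambda\mapsto p^*_\varepsilon(\lambda)$ has finite total variation on $(0,\lambda_\varepsilon]$. 3. $\|p^*_\varepsilon(\lambda)-p^*_\varepsilon\|=O(\lambda)$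 as $\lambda\downarrow0$. **Algorithm (alternate MDSA).** Given $p^1\in\mathcal P(\varepsilon)$, step sizes $\gamma^k>0$, penalty coefficients $\lambda^k>0$, and positive integers $M_1^k,M_2,M_3$, for $k=1,2,\dots$: given $p^k$ and the past, simulate mutually independent input sequences $\mathbf X^{(r)}$ ($r\le M_1^k$, length $T$), $\tilde{\mathbf X}^{(r)}$ ($r\le M_2$, length $T$), $\tilde{\tilde{\mathbf X}}^{(r)}$ ($r\le M_3$, length $S$), each i.i.d. under $p^k$. Compute $$u_j^k=\frac1{M_1^k}\sum_{r=1}^{M_1^k}I(h(\mathbf X^{(r)})\le y_j),\qquad \hat\phi_i^k=2\sum_{j=1}^n(u_j^k-\Pi_j(u_j^k))\frac1{M_2}\sum_{r=1}^{M_2}I(h(\tilde{\mathbf X}^{(r)})\le y_j)\,S_i(\tilde{\mathbf X}^{(r)};p^k),$$ $$\hat\Psi_i^k=\frac1{M_3}\sum_{r=1}^{M_3}g(\tilde{\tilde{\mathbf X}}^{(r)})\,S_i(\tilde{\tilde{\mathbf X}}^{(r)};p^k),$$ where $S_i(\mathbf x;p)=\#\{t:x_t=z_i\}/p_i-L$ for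 a sequence of length $L$ (draws are counted by the label $i$ of the support point). Set $\xi_i=\gamma^k(\lambda^k\hat\Psi_i^k+\hat\phi_i^k)$ and $w_i=p_i^ke^{-\xi_i}$, sort them as $w_{(1)}\le\dots\le w_{(m)}$, put $w_{(0)}=0$, find $i^*\in\{0,\dots,m-1\}$ with $$\frac{w_{(i^*)}}{i^*w_{(i^*)}+\sum_{i=i^*+1}^mw_{(i)}}\le\varepsilon<\frac{w_{(i^*+1)}}{(i^*+1)w_{(i^*+1)}+\sum_{i=i^*+2}^mw_{(i)}},$$ and set $\eta^*=\varepsilon\sum_{i=i^*+1}^mw_{(i)}/(1-\varepsilon i^*)$ and $p_i^{k+1}=\max\{\eta^*,w_i\}/\sum_{l=1}^m\max\{\eta^*,w_l\}$. **Theorem.** Suppose Assumptions 1–3 hold. (a) If $\sum_k\gamma^k\lambda^k=\infty$, $\sum_k(\gamma^k)^2<\infty$, $\sum_k\gamma^k/\sqrt{M_1^k}<\infty$, $\lambda^k\to0$ and $\lambda^k$ is non-increasing, then $p^k\to p^*_\varepsilon$ almost surely. (b) In particular $p^k\to p^*_\varepsilon$ almost surely if, for some $a,b,c>0$, $\gamma^k=a/k^{\alpha_1}$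 with $\frac12<\alpha_1\le1$; $M_1^k$ is $bk^{\alpha_2}$ rounded to a positive integer (that is, $|M_1^k-bk^{\alpha_2}|<1$) with $\alpha_2>2(1-\alpha_1)$; and either $\alpha_1<1$ and $\lambda^k=c/k^{\alpha_3}$ with $0<\alpha_3\le1-\alpha_1$, or $\alpha_1=1$ and $\lambda^k=c/\log k$ for $k\ge2$ (with $\lambda^1>0$ arbitrary). -/

import Mathlib

open MeasureTheory ProbabilityTheory Filter Topology Asymptotics

noncomputable section

namespace SimCalib

/-- Data of the discretized calibration problem (no laws are imposed). The input variates take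
values in `𝒳`; the candidate input distributions put weights `p i` on the `m` support points `z i`.
The system logic is `h`, with horizon `T`; the performance function of the target quantity is `g`,
with horizon `S`; `y` is the vector of the `n` observed outputs; `q` is the critical value that
scales the width of the Kolmogorov-Smirnov band (any real number is allowed). -/
structure Model (𝒳 : Type*) where
  m : ℕ
  n : ℕ
  T : ℕ
  S : ℕ
  z : Fin m → 𝒳
  h : (Fin T → 𝒳) → ℝ
  g : (Fin S → 𝒳) → ℝ
  y : Fin n → ℝ
  q : ℝ

/-- The restricted probability simplex `𝒫(ε)`. -/
def restrictedSimplex (m : ℕ) (ε : ℝ) : Set (Fin m → ℝ) :=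
  {p | ∑ i, p i = 1 ∧ ∀ i, ε ≤ p i}

/-- Probability, under i.i.d. draws from the weights `p`, of the sequence of labels `x`. -/
def seqProb {m L : ℕ} (p : Fin m → ℝ) (x : Fin L → Fin m) : ℝ := ∏ t, p (x t)

/-- The score function `S_i(x; p) = ∑ₜ 1{xₜ = zᵢ} / pᵢ - L`, for the input sequence
`(z (x 1), …, z (x L))` that is recorded by its labels `x`. -/
def score {m L : ℕ} (i : Fin m) (x : Fin L → Fin m) (p : Fin m → ℝ) : ℝ :=
  (∑ t, if x t = i then 1 / p i else 0) - L

/-- Gateaux derivative: right derivative at `t = 0` of `t ↦ F ((1 - t) p + t 1ᵢ)`. -/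
def gateaux {m : ℕ} (F : (Fin m → ℝ) → ℝ) (p : Fin m → ℝ) (i : Fin m) : ℝ :=
  derivWithin (fun t : ℝ => F ((1 - t) • p + t • Pi.single i (1 : ℝ))) (Set.Ici 0) 0

/-- `x` is the unique minimizer of `f` over `s`. -/
def IsUniqueMin {E : Type*} (f : E → ℝ) (s : Set E) (x : E) : Prop :=
  x ∈ s ∧ IsMinOn f s x ∧ ∀ x' ∈ s, IsMinOn f s x' → x' = x

/-- The empirical distribution function of the data `y`. -/
def empCDF {n : ℕ} (y : Fin n → ℝ) (u : ℝ) : ℝ :=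
  ((Finset.univ.filter fun j => y j ≤ u).card : ℝ) / n

namespace Model

variable {𝒳 : Type*} (P : Model 𝒳)

/-- The input sequence in `𝒳` whose labels are `x`. -/
def input {L : ℕ} (x : Fin L → Fin P.m) : Fin L → 𝒳 := fun t => P.z (x t)

/-- `E_p[f(X)]` for `X = (X_1, …, X_L)` i.i.d. with weights `p` on the support points. -/
def expect {L : ℕ} (p : Fin P.m → ℝ) (f : (Fin L → 𝒳) → ℝ) : ℝ :=
  ∑ x : Fin L → Fin P.m, seqProb p x * f (P.input x)

/-- The indicator `I(h(x) ≤ y_j)`. -/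
def below (j : Fin P.n) (x : Fin P.T → 𝒳) : ℝ :=
  Set.indicator {x | P.h x ≤ P.y j} (fun _ => (1 : ℝ)) x

/-- The target quantity `ψ(p) = E_p[g(X)]`. -/
def psi (p : Fin P.m → ℝ) : ℝ := P.expect p P.g

/-- The constrained quantity `E_p[I(h(X) ≤ y_j)]`. -/
def outProb (j : Fin P.n) (p : Fin P.m → ℝ) : ℝ := P.expect p (P.below j)

/-- Lower end `F̂(y_j+) - q / √n` of the `j`-th band. -/
def lo (j : Fin P.n) : ℝ := Function.rightLim (empCDF P.y) (P.y j) - P.q / √(P.n : ℝ)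

/-- Upper end `F̂(y_j-) + q / √n` of the `j`-th band. -/
def hi (j : Fin P.n) : ℝ := Function.leftLim (empCDF P.y) (P.y j) + P.q / √(P.n : ℝ)

/-- The projection `Π_j` onto the `j`-th band. -/
def proj (j : Fin P.n) (u : ℝ) : ℝ :=
  if u < P.lo j then P.lo j else if P.hi j < u then P.hi j else u

/-- The quadratic penalty `W(p) = ∑ⱼ (E_p[I(h(X) ≤ y_j)] - Π_j(E_p[I(h(X) ≤ y_j)]))²`. -/
def penalty (p : Fin P.m → ℝ) : ℝ :=
  ∑ j, (P.outProb j p - P.proj j (P.outProb j p)) ^ 2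

/-- `Ψ(p)`, the vector of Gateaux derivatives of `ψ`. -/
def gradPsi (p : Fin P.m → ℝ) : Fin P.m → ℝ := gateaux P.psi p

/-- `φ(p)`, the vector of Gateaux derivatives of the penalty. -/
def gradPenalty (p : Fin P.m → ℝ) : Fin P.m → ℝ := gateaux P.penalty p

/-- Feasible set of the restricted program. -/
def feasible (ε : ℝ) : Set (Fin P.m → ℝ) :=
  {p | p ∈ restrictedSimplex P.m ε ∧ ∀ j, P.lo j ≤ P.outProb j p ∧ P.outProb j p ≤ P.hi j}

/-- First assumption: `pstar` is the unique optimal solution of the restricted program, with the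
strict gradient conditions at the other feasible points and at the infeasible points. -/
def ConstrainedCond (ε : ℝ) (pstar : Fin P.m → ℝ) : Prop :=
  IsUniqueMin P.psi (P.feasible ε) pstar ∧
  (∀ p ∈ P.feasible ε, p ≠ pstar → 0 < P.gradPsi p ⬝ᵥ (p - pstar)) ∧
  (∀ p ∈ restrictedSimplex P.m ε, p ∉ P.feasible ε → 0 < P.gradPenalty p ⬝ᵥ (p - pstar))

/-- Second assumption, with threshold `lamε`: `path l` is the unique optimal solution of the
penalized program with coefficient `l`, with the gradient condition, and the path has finite total
variation on `(0, lamε]`. -/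
def PenalizedCond (ε lamε : ℝ) (path : ℝ → Fin P.m → ℝ) : Prop :=
  0 < lamε ∧
  (∀ l ∈ Set.Ioc 0 lamε,
    IsUniqueMin (fun p => l * P.psi p + P.penalty p) (restrictedSimplex P.m ε) (path l) ∧
    ∀ p ∈ restrictedSimplex P.m ε, 0 ≤ (l • P.gradPsi p + P.gradPenalty p) ⬝ᵥ (p - path l)) ∧
  BoundedVariationOn path (Set.Ioc 0 lamε)

/-- Third assumption: `‖path l - pstar‖ = O(l)` as `l ↓ 0`. -/
def PathRateCond (pstar : Fin P.m → ℝ) (path : ℝ → Fin P.m → ℝ) : Prop :=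
  (fun l => path l - pstar) =O[𝓝[>] (0 : ℝ)] (fun l : ℝ => l)

/-- The batch mean `u_j` of `I(h(X) ≤ y_j)` over the replications `X`. -/
def uHat {M : ℕ} (X : Fin M → Fin P.T → Fin P.m) (j : Fin P.n) : ℝ :=
  1 / (M : ℝ) * ∑ r, P.below j (P.input (X r))

/-- The plug-in estimator of `φ_i(p)` from the replications `X` and `X'`. -/
def gradPenaltyHat {M M' : ℕ} (p : Fin P.m → ℝ) (X : Fin M → Fin P.T → Fin P.m)
    (X' : Fin M' → Fin P.T → Fin P.m) (i : Fin P.m) : ℝ :=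
  2 * ∑ j, (P.uHat X j - P.proj j (P.uHat X j)) *
    (1 / (M' : ℝ) * ∑ r, P.below j (P.input (X' r)) * score i (X' r) p)

/-- The estimator of `Ψ_i(p)` from the replications `X`. -/
def gradPsiHat {M : ℕ} (p : Fin P.m → ℝ) (X : Fin M → Fin P.S → Fin P.m) (i : Fin P.m) : ℝ :=
  1 / (M : ℝ) * ∑ r, P.g (P.input (X r)) * score i (X r) p

end Model

/-- The `i`-th smallest entry `w_(i)` of `w`, for `1 ≤ i ≤ m`, with `w_(0) = 0`. -/
def orderStat {m : ℕ} (w : Fin m → ℝ) (i : ℕ) : ℝ :=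
  if hi : 1 ≤ i ∧ i ≤ m then w (Tuple.sort w ⟨i - 1, by omega⟩) else 0

/-- `q'` is the output of the sort-and-search routine on the input `p`, `ξ`: the entries of
`w i = p i * exp (-ξ i)` are sorted, an index `s` in `{0, …, m - 1}` is searched for, and the
output is formed with the threshold `η`. -/
def IsSortSearchOutput {m : ℕ} (ε : ℝ) (p ξ q' : Fin m → ℝ) : Prop :=
  let w : Fin m → ℝ := fun i => p i * Real.exp (-ξ i)
  let v : ℕ → ℝ := orderStat w
  ∃ s : ℕ, s < m ∧
    v s / (s * v s + ∑ i ∈ Finset.Icc (s + 1) m, v i) ≤ ε ∧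
    ε < v (s + 1) / ((s + 1) * v (s + 1) + ∑ i ∈ Finset.Icc (s + 2) m, v i) ∧
    let η : ℝ := ε * (∑ i ∈ Finset.Icc (s + 1) m, v i) / (1 - ε * s)
    ∀ i, q' i = max η (w i) / ∑ i', max η (w i')

/-- The process `p 1, p 2, …` is generated by the alternate mirror descent stochastic
approximation algorithm. At iteration `k ≥ 1`, `ℱ k` is the past (which contains `p k` and all the
earlier replications) and, given the past, the replications `X₁ k r`, `X₂ k r`, `X₃ k r` are
mutually independent, each an i.i.d. input sequence under `p k`. -/
structure IsAltMDSA {𝒳 Ω : Type*} (P : Model 𝒳) (ε : ℝ) (γ lam : ℕ → ℝ)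
    (M₁ : ℕ → ℕ) (M₂ M₃ : ℕ) [mΩ : MeasurableSpace Ω] (μ : Measure Ω) (ℱ : Filtration ℕ mΩ)
    (p : ℕ → Ω → Fin P.m → ℝ)
    (X₁ : (k : ℕ) → Fin (M₁ k) → Ω → Fin P.T → Fin P.m)
    (X₂ : ℕ → Fin M₂ → Ω → Fin P.T → Fin P.m)
    (X₃ : ℕ → Fin M₃ → Ω → Fin P.S → Fin P.m) : Prop where
  init : ∀ ω, p 1 ω ∈ restrictedSimplex P.m ε
  adapted : ∀ k, 1 ≤ k → Measurable[ℱ k] (p k)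
  meas₁ : ∀ k, 1 ≤ k → ∀ r, Measurable[ℱ (k + 1)] (X₁ k r)
  meas₂ : ∀ k, 1 ≤ k → ∀ r, Measurable[ℱ (k + 1)] (X₂ k r)
  meas₃ : ∀ k, 1 ≤ k → ∀ r, Measurable[ℱ (k + 1)] (X₃ k r)
  sampling : ∀ k, 1 ≤ k → ∀ (x₁ : Fin (M₁ k) → Fin P.T → Fin P.m)
    (x₂ : Fin M₂ → Fin P.T → Fin P.m) (x₃ : Fin M₃ → Fin P.S → Fin P.m),
    μ[Set.indicator {ω | (∀ r, X₁ k r ω = x₁ r) ∧ (∀ r, X₂ k r ω = x₂ r) ∧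
        (∀ r, X₃ k r ω = x₃ r)} (fun _ => (1 : ℝ)) | ℱ k]
      =ᵐ[μ] fun ω => (∏ r, seqProb (p k ω) (x₁ r)) * (∏ r, seqProb (p k ω) (x₂ r)) *
        ∏ r, seqProb (p k ω) (x₃ r)
  update : ∀ k, 1 ≤ k → ∀ ω, IsSortSearchOutput ε (p k ω)
    (fun i => γ k * (lam k * P.gradPsiHat (p k ω) (fun r => X₃ k r ω) i +
      P.gradPenaltyHat (p k ω) (fun r => X₁ k r ω) (fun r => X₂ k r ω) i))
    (p (k + 1) ω)

/-- General conditions on the step sizes, penalty coefficients and batch sizes (`k = 1, 2, …`). -/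
def StepCond (γ lam : ℕ → ℝ) (M₁ : ℕ → ℕ) : Prop :=
  Tendsto (fun N : ℕ => ∑ k ∈ Finset.Icc 1 N, γ k * lam k) atTop atTop ∧
  Summable (fun k => γ k ^ 2) ∧
  Summable (fun k => γ k / √(M₁ k : ℝ)) ∧
  Tendsto lam atTop (𝓝 0) ∧
  ∀ k, 1 ≤ k → lam (k + 1) ≤ lam k

/-- The polynomial choice of the sequences. The batch size `b k ^ α₂` is rounded to an integer in
any way; as `log 1 = 0`, the formula `c / log k` is imposed for `k ≥ 2` only. -/
def PolyChoice (γ lam : ℕ → ℝ) (M₁ : ℕ → ℕ) : Prop :=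
  ∃ a b c α₁ α₂ : ℝ, 0 < a ∧ 0 < b ∧ 0 < c ∧ 1 / 2 < α₁ ∧ α₁ ≤ 1 ∧ 2 * (1 - α₁) < α₂ ∧
    (∀ k, 1 ≤ k → γ k = a / (k : ℝ) ^ α₁) ∧
    (∀ k, 1 ≤ k → |(M₁ k : ℝ) - b * (k : ℝ) ^ α₂| < 1) ∧
    ((α₁ < 1 ∧ ∃ α₃ : ℝ, 0 < α₃ ∧ α₃ ≤ 1 - α₁ ∧ ∀ k, 1 ≤ k → lam k = c / (k : ℝ) ^ α₃) ∨
      (α₁ = 1 ∧ ∀ k, 2 ≤ k → lam k = c / Real.log k))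

end SimCalib

end

-- The Lyapunov function is the divergence `klDivSum` of the moving target `path (lam k)`, the
-- minimizer of the penalized problem, from the iterate `p k`. The sort-and-search output is max(ε,
-- c·w) with total mass one. This is the optimality condition of an entropic mirror descent step, so
-- one iteration changes KL(q, p) by at most −ξ·(p − q) + ∑ ξᵢ². Conditional expectation turns ξ
-- into γ(λΨ + φ) up to a bias: score functions make the derivative factors unbiased, and
-- independence of the first two batches leaves only the error of passing a batch mean through the
-- 1-Lipschitz map u − Π(u), of order 1/√M₁. Moving the target to `path (lam (k + 1))` costs a
-- multiple of its displacement. These displacements are summable since the path has bounded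
-- variation and the coefficients decrease.
--
-- The divergence is thus an almost-supermartingale with summable errors, and its drift is
-- nonnegative by the second assumption. By Robbins-Siegmund it converges almost surely and ∑
-- γ·drift is finite. If the limit were positive, the iterates would eventually stay at a fixed
-- distance from `pstar`, where the drift is at least cλ (`exists_drift_ge`), and ∑ γλ would be
-- finite. So the limit is zero, and the Pinsker-type bound `klDivSum_ge_sq` together with `path l →
-- pstar` gives the claim.
--
-- The drift bound is an exact-penalty argument: Ψ·(p − pstar) is positive at the other feasible
-- points, φ·(p − pstar) at infeasible ones, and compactness combines the two uniformly. The rate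
-- assumption controls the replacement of `path l` by `pstar`.

namespace SimCalib

-- Kullback-Leibler divergence on the restricted simplex.

/-- The Kullback-Leibler divergence `∑ qᵢ log (qᵢ / pᵢ)`. -/
noncomputable def klDivSum {m : ℕ} (q p : Fin m → ℝ) : ℝ :=
  ∑ i, q i * (Real.log (q i) - Real.log (p i))

theorem restrictedSimplex_pos {m : ℕ} {ε : ℝ} (hε : 0 < ε) {p : Fin m → ℝ}
    (hp : p ∈ restrictedSimplex m ε) (i : Fin m) : 0 < p i :=
  hε.trans_le (hp.2 i)

theorem restrictedSimplex_le_one {m : ℕ} {ε : ℝ} (hε : 0 < ε) {p : Fin m → ℝ}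
    (hp : p ∈ restrictedSimplex m ε) (i : Fin m) : p i ≤ 1 := by
  rw [← hp.1]
  exact Finset.single_le_sum (f := p) (fun j _ => (restrictedSimplex_pos hε hp j).le)
    (Finset.mem_univ i)

theorem isCompact_restrictedSimplex {m : ℕ} {ε : ℝ} (hε : 0 < ε) :
    IsCompact (restrictedSimplex m ε) := by
  have hK : IsCompact (Set.univ.pi fun _ : Fin m => Set.Icc ε 1) :=
    isCompact_univ_pi fun _ => isCompact_Icc
  refine hK.of_isClosed_subset ?_ fun p hp i _ => ⟨hp.2 i, restrictedSimplex_le_one hε hp i⟩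
  have h1 : IsClosed {p : Fin m → ℝ | ∑ i, p i = 1} :=
    isClosed_eq (by fun_prop) continuous_const
  have h2 : IsClosed {p : Fin m → ℝ | ∀ i, ε ≤ p i} := by
    simp only [Set.ofPred_forall]
    exact isClosed_iInter fun i => isClosed_le continuous_const (continuous_apply i)
  exact h1.inter h2

/-- Apply log x ≤ x − 1 to √(b/a): the right side is at least 2a − 2√(ab) = a − b + (√a − √b)².
Since √a + √b ≤ 2, the last square dominates (a − b)²/4. -/
theorem mul_log_sub_log_ge {a b : ℝ} (ha : 0 < a) (hb : 0 < b) (ha1 : a ≤ 1) (hb1 : b ≤ 1) :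
    a - b + (a - b) ^ 2 / 4 ≤ a * (Real.log a - Real.log b) := by
  have hsa := Real.sqrt_pos.2 ha
  have hsb := Real.sqrt_pos.2 hb
  have ea := Real.sq_sqrt ha.le
  have eb := Real.sq_sqrt hb.le
  have sa1 : √a ≤ 1 := Real.sqrt_le_one.2 ha1
  have sb1 : √b ≤ 1 := Real.sqrt_le_one.2 hb1
  have hl : Real.log a - Real.log b = -(2 * Real.log (√b / √a)) := by
    rw [Real.log_div hsb.ne' hsa.ne', Real.log_sqrt ha.le, Real.log_sqrt hb.le]; ring
  have h1 : Real.log (√b / √a) ≤ √b / √a - 1 := Real.log_le_sub_one_of_pos (by positivity)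
  have h2 : a * (√b / √a) = √a * √b := by
    field_simp; rw [ea]
  have h3 : a * Real.log (√b / √a) ≤ √a * √b - a := by
    have := mul_le_mul_of_nonneg_left h1 ha.le
    rw [mul_sub, h2, mul_one] at this; exact this
  rw [hl]
  have h4 : (a - b) ^ 2 ≤ 4 * (√a - √b) ^ 2 := by
    have : a - b = (√a - √b) * (√a + √b) := by nlinarith
    rw [this, mul_pow]
    have : (√a + √b) ^ 2 ≤ 4 := by nlinarith
    nlinarith [sq_nonneg (√a - √b)]
  nlinarith

/-- The linear terms of the scalar bound cancel because both vectors have mass one. -/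
theorem klDivSum_ge_sq {m : ℕ} {ε : ℝ} (hε : 0 < ε) {p q : Fin m → ℝ}
    (hp : p ∈ restrictedSimplex m ε) (hq : q ∈ restrictedSimplex m ε) :
    ∑ i, (q i - p i) ^ 2 / 4 ≤ klDivSum q p := by
  have h : ∑ i, (q i - p i + (q i - p i) ^ 2 / 4) ≤ klDivSum q p :=
    Finset.sum_le_sum fun i _ => mul_log_sub_log_ge (restrictedSimplex_pos hε hq i)
      (restrictedSimplex_pos hε hp i) (restrictedSimplex_le_one hε hq i)
      (restrictedSimplex_le_one hε hp i)
  rw [Finset.sum_add_distrib, Finset.sum_sub_distrib, hq.1, hp.1] at h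
  linarith

theorem klDivSum_nonneg {m : ℕ} {ε : ℝ} (hε : 0 < ε) {p q : Fin m → ℝ}
    (hp : p ∈ restrictedSimplex m ε) (hq : q ∈ restrictedSimplex m ε) : 0 ≤ klDivSum q p :=
  (Finset.sum_nonneg fun i _ => by positivity).trans (klDivSum_ge_sq hε hp hq)

/-- Pays for moving the target. Write the difference as (q − q')·log(q/p) + q'·log(q/q'): logarithms
lie between log ε and 0 in the first term, and the second is at most q − q', the source of the
summand 1. -/
theorem klDivSum_sub_le {m : ℕ} {ε : ℝ} (hε : 0 < ε) {p q q' : Fin m → ℝ}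
    (hp : p ∈ restrictedSimplex m ε) (hq : q ∈ restrictedSimplex m ε)
    (hq' : q' ∈ restrictedSimplex m ε) :
    klDivSum q p - klDivSum q' p ≤ (1 - 2 * Real.log ε) * ∑ i, |q i - q' i| := by
  unfold klDivSum
  rw [← Finset.sum_sub_distrib, Finset.mul_sum]
  refine Finset.sum_le_sum fun i _ => ?_
  have pos := fun {x : Fin m → ℝ} (hx : x ∈ restrictedSimplex m ε) =>
    restrictedSimplex_pos hε hx i
  have lge := fun {x : Fin m → ℝ} (hx : x ∈ restrictedSimplex m ε) =>
    Real.log_le_log hε (hx.2 i)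
  have lle := fun {x : Fin m → ℝ} (hx : x ∈ restrictedSimplex m ε) =>
    Real.log_nonpos (pos hx).le (restrictedSimplex_le_one hε hx i)
  have h1 : q' i * (Real.log (q i) - Real.log (q' i)) ≤ q i - q' i := by
    have := Real.log_le_sub_one_of_pos (div_pos (pos hq) (pos hq'))
    rw [Real.log_div (pos hq).ne' (pos hq').ne'] at this
    have h2 := mul_le_mul_of_nonneg_left this (pos hq').le
    rwa [mul_sub _ (_ / _), mul_div_cancel₀ _ (pos hq').ne', mul_one] at h2
  have h2 : (q i - q' i) * (Real.log (q i) - Real.log (p i))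
      ≤ |q i - q' i| * (-2 * Real.log ε) := by
    refine (le_abs_self _).trans ?_
    rw [abs_mul]
    refine mul_le_mul_of_nonneg_left ?_ (abs_nonneg _)
    rw [abs_le]; constructor <;> linarith [lge hq, lge hp, lle hq, lle hp]
  have h3 := le_abs_self (q i - q' i)
  nlinarith

theorem klDivSum_self {m : ℕ} (p : Fin m → ℝ) : klDivSum p p = 0 := by simp [klDivSum]

theorem klDivSum_le {m : ℕ} {ε : ℝ} (hε : 0 < ε) {p q : Fin m → ℝ}
    (hp : p ∈ restrictedSimplex m ε) (hq : q ∈ restrictedSimplex m ε) :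
    klDivSum q p ≤ (1 - 2 * Real.log ε) * ∑ i, |q i - p i| := by
  simpa [klDivSum_self] using klDivSum_sub_le hε hp hq hp

-- The sort-and-search routine as an entropic mirror descent step.

theorem sum_orderStat {m : ℕ} (w : Fin m → ℝ) (f : ℝ → ℝ) :
    ∑ i ∈ Finset.Icc 1 m, f (orderStat w i) = ∑ i, f (w i) := by
  rw [← Equiv.sum_comp (Tuple.sort w) fun i => f (w i), ← Finset.Ico_add_one_right_eq_Icc,
    Finset.sum_Ico_eq_sum_range, Nat.add_sub_cancel, Finset.sum_range]
  refine Finset.sum_congr rfl fun i _ => ?_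
  have : 1 ≤ 1 + (i : ℕ) ∧ 1 + (i : ℕ) ≤ m := by omega
  simp [orderStat, this]

theorem orderStat_pos {m : ℕ} {w : Fin m → ℝ} (hw : ∀ i, 0 < w i) {i : ℕ} (h1 : 1 ≤ i)
    (hm : i ≤ m) : 0 < orderStat w i := by
  simp only [orderStat, h1, hm, and_self, dite_true]
  exact hw _

theorem orderStat_mono {m : ℕ} (w : Fin m → ℝ) {i j : ℕ} (h1 : 1 ≤ i) (hij : i ≤ j)
    (hm : j ≤ m) : orderStat w i ≤ orderStat w j := by
  simp only [orderStat, h1, hm, h1.trans hij, hij.trans hm, and_self, dite_true]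
  exact Tuple.monotone_sort w (Fin.mk_le_mk.2 (by omega))

/-- The output of the sort-and-search routine is the projected exponential weight vector. -/
theorem IsSortSearchOutput.exists_eq_max {m : ℕ} {ε : ℝ} (hε : 0 < ε) (hεm : ε < 1 / (m : ℝ))
    {p ξ q' : Fin m → ℝ} (hp : ∀ i, 0 < p i) (h : IsSortSearchOutput ε p ξ q') :
    ∃ c : ℝ, 0 < c ∧ (∀ i, q' i = max ε (c * (p i * Real.exp (-ξ i)))) ∧ ∑ i, q' i = 1 := by
  obtain ⟨s, hsm, h1, h2, h3⟩ := h
  set w : Fin m → ℝ := fun i => p i * Real.exp (-ξ i) with hw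
  have hwpos : ∀ i, 0 < w i := fun i => mul_pos (hp i) (Real.exp_pos _)
  set v := orderStat w with hv
  set A := ∑ i ∈ Finset.Icc (s + 1) m, v i with hA
  set η := ε * A / (1 - ε * s) with hη
  have hm : (0 : ℝ) < m := by exact_mod_cast (Nat.zero_le s).trans_lt hsm
  have hs' : (s : ℝ) < m := by exact_mod_cast hsm
  have hεm' : ε * m < 1 := by rwa [lt_div_iff₀ hm] at hεm
  have hd : 0 < 1 - ε * s := by nlinarith
  have hvs1 : 0 < v (s + 1) := orderStat_pos hwpos (by omega) (by omega)
  have hAeq : A = v (s + 1) + ∑ i ∈ Finset.Icc (s + 2) m, v i := by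
    rw [hA, ← Finset.insert_Icc_add_one_left_eq_Icc (by omega : s + 1 ≤ m),
      Finset.sum_insert (by simp)]
    rfl
  have hB : 0 ≤ ∑ i ∈ Finset.Icc (s + 2) m, v i := Finset.sum_nonneg fun i hi => by
    rw [Finset.mem_Icc] at hi
    exact (orderStat_pos hwpos (by omega) hi.2).le
  have hApos : 0 < A := by rw [hAeq]; positivity
  have hηpos : 0 < η := by positivity
  have hvs0 : 0 ≤ v s := by
    rcases Nat.eq_zero_or_pos s with rfl | hs
    · simp [hv, orderStat]
    · exact (orderStat_pos hwpos hs hsm.le).le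
  -- With denominators cleared, the two search inequalities say v s ≤ η < v (s + 1); `orderStat w 0
  -- = 0` covers s = 0.
  have hle : v s ≤ η := by
    rw [hη, le_div_iff₀ hd]
    rw [div_le_iff₀ (by positivity)] at h1
    nlinarith
  have hge : η ≤ v (s + 1) := by
    rw [hη, div_le_iff₀ hd]
    rw [lt_div_iff₀ (by positivity)] at h2
    rw [hAeq]; nlinarith
  -- The s smallest entries are raised to η and the rest sum to A, so the total is sη + A, which the
  -- choice of η makes η/ε. After normalization the threshold becomes exactly ε, with c = ε/η.
  have hZ : ∑ i, max η (w i) = η / ε := by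
    rw [← sum_orderStat w (fun x => max η x)]
    have hsplit : Finset.Icc 1 m = Finset.Icc 1 s ∪ Finset.Icc (s + 1) m := by
      ext i; simp only [Finset.mem_Icc, Finset.mem_union]; omega
    rw [hsplit, Finset.sum_union (Finset.disjoint_left.2 fun i hi hi' => by
      rw [Finset.mem_Icc] at hi hi'; omega)]
    have e1 : ∑ i ∈ Finset.Icc 1 s, max η (orderStat w i) = s * η := by
      have : ∀ i ∈ Finset.Icc 1 s, max η (orderStat w i) = η := fun i hi => by
        rw [Finset.mem_Icc] at hi
        exact max_eq_left ((orderStat_mono w hi.1 hi.2 hsm.le).trans hle)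
      rw [Finset.sum_congr rfl this]
      simp
    have e2 : ∑ i ∈ Finset.Icc (s + 1) m, max η (orderStat w i) = A := by
      refine Finset.sum_congr rfl fun i hi => ?_
      rw [Finset.mem_Icc] at hi
      exact max_eq_right (hge.trans (orderStat_mono w (by omega) hi.1 hi.2))
    have e3 : η * (1 - ε * s) = ε * A := div_mul_cancel₀ _ hd.ne'
    rw [e1, e2, eq_div_iff hε.ne']
    linarith
  refine ⟨ε / η, by positivity, fun i => ?_, ?_⟩
  · have e : max ε (ε / η * w i) = ε / η * max η (w i) := by
      rw [mul_max_of_nonneg _ _ (by positivity), div_mul_cancel₀ _ hηpos.ne']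
    rw [h3 i, hZ]
    exact (e.trans (by field_simp)).symm
  · simp_rw [h3]
    rw [← Finset.sum_div, hZ, div_self (by positivity)]

theorem IsSortSearchOutput.mem_restrictedSimplex {m : ℕ} {ε : ℝ} (hε : 0 < ε)
    (hεm : ε < 1 / (m : ℝ)) {p ξ q' : Fin m → ℝ} (hp : p ∈ restrictedSimplex m ε)
    (h : IsSortSearchOutput ε p ξ q') : q' ∈ restrictedSimplex m ε := by
  obtain ⟨c, -, h1, h2⟩ := h.exists_eq_max hε hεm (restrictedSimplex_pos hε hp)
  exact ⟨h2, fun i => by rw [h1]; exact le_max_left _ _⟩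

/-- One step of entropic mirror descent on the restricted simplex. -/
theorem IsSortSearchOutput.klDivSum_le {m : ℕ} {ε : ℝ} (hε : 0 < ε) (hεm : ε < 1 / (m : ℝ))
    {p ξ q' q : Fin m → ℝ} (hp : p ∈ restrictedSimplex m ε) (hq : q ∈ restrictedSimplex m ε)
    (h : IsSortSearchOutput ε p ξ q') :
    klDivSum q q' ≤ klDivSum q p - ∑ i, ξ i * (p i - q i) + ∑ i, ξ i ^ 2 := by
  have hq' := h.mem_restrictedSimplex hε hεm hp
  obtain ⟨c, hc, h1, h2⟩ := h.exists_eq_max hε hεm (restrictedSimplex_pos hε hp)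
  -- Complementary slackness: the second factor vanishes where the floor is inactive; where q' i = ε
  -- both factors are nonnegative.
  have key : ∀ i, 0 ≤ (q i - q' i) * (Real.log (q' i) - Real.log (p i) + ξ i - Real.log c) := by
    intro i
    have hpi := restrictedSimplex_pos hε hp i
    have hl : Real.log (c * (p i * Real.exp (-ξ i))) = Real.log c + (Real.log (p i) - ξ i) := by
      rw [Real.log_mul hc.ne' (by positivity), Real.log_mul hpi.ne' (Real.exp_pos _).ne',
        Real.log_exp]
      ring
    rcases le_total ε (c * (p i * Real.exp (-ξ i))) with hle | hle
    · rw [h1 i, max_eq_right hle, hl]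
      apply le_of_eq; ring
    · have e := h1 i
      rw [max_eq_left hle] at e
      rw [e]
      refine mul_nonneg (sub_nonneg.2 (hq.2 i)) ?_
      have := Real.log_le_log (by positivity) hle
      rw [hl] at this
      linarith
  have hsum := Finset.sum_nonneg fun i (_ : i ∈ Finset.univ) => key i
  have hquad := klDivSum_ge_sq hε hp hq'
  have e0 : ∑ i, (q i - q' i) * Real.log c = 0 := by
    rw [← Finset.sum_mul, Finset.sum_sub_distrib, hq.1, hq'.1, sub_self, zero_mul]
  -- Three-point identity for the divergence; the multiplier log c drops out because q and q' have
  -- equal mass.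
  have e1 : ∑ i, (q i - q' i) * (Real.log (q' i) - Real.log (p i) + ξ i - Real.log c) =
      klDivSum q p - klDivSum q q' - klDivSum q' p + ∑ i, (q i - q' i) * ξ i
        - ∑ i, (q i - q' i) * Real.log c := by
    simp only [klDivSum, ← Finset.sum_sub_distrib, ← Finset.sum_add_distrib]
    exact Finset.sum_congr rfl fun i _ => by ring
  -- Young's inequality; the term (q' − p)²/4 is then absorbed by KL(q', p) through `hquad`.
  have h3 : ∑ i, (q i - q' i) * ξ i ≤
      -(∑ i, ξ i * (p i - q i)) + ∑ i, ξ i ^ 2 + ∑ i, (q' i - p i) ^ 2 / 4 := by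
    simp only [← Finset.sum_neg_distrib, ← Finset.sum_add_distrib]
    exact Finset.sum_le_sum fun i _ => by nlinarith [sq_nonneg (ξ i + (q' i - p i) / 2)]
  rw [e1, e0] at hsum
  linarith

-- Gateaux derivatives and score functions.

theorem hasDerivAt_of_sq_bound {r : ℝ → ℝ} {x r' : ℝ}
    (h : ∀ y, |r y - r x - r' * (y - x)| ≤ (y - x) ^ 2) : HasDerivAt r r' x := by
  rw [hasDerivAt_iff_isLittleO]
  refine IsBigO.trans_isLittleO (g := fun y => ‖y - x‖ ^ 2) (IsBigO.of_bound 1 ?_)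
    (isLittleO_pow_sub_sub x one_lt_two)
  refine Eventually.of_forall fun y => ?_
  rw [one_mul, norm_pow, norm_norm, Real.norm_eq_abs, Real.norm_eq_abs, sq_abs, smul_eq_mul,
    mul_comm (y - x)]
  exact h y

theorem gateaux_eq_of_hasDerivAt {m : ℕ} {F : (Fin m → ℝ) → ℝ} {p : Fin m → ℝ} {i : Fin m} {d : ℝ}
    (h : HasDerivAt (fun t : ℝ => F ((1 - t) • p + t • Pi.single i (1 : ℝ))) d 0) :
    gateaux F p i = d :=
  h.hasDerivWithinAt.derivWithin (uniqueDiffOn_Ici 0 0 Set.self_mem_Ici)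

theorem seqProb_nonneg {m L : ℕ} {p : Fin m → ℝ} (hp : ∀ i, 0 ≤ p i) (x : Fin L → Fin m) :
    0 ≤ seqProb p x := Finset.prod_nonneg fun _ _ => hp _

theorem sum_seqProb {m L : ℕ} {p : Fin m → ℝ} (hp : ∑ i, p i = 1) :
    ∑ x : Fin L → Fin m, seqProb p x = 1 := by
  simp only [seqProb]
  rw [← Fintype.piFinset_univ, ← Finset.prod_univ_sum (fun _ => Finset.univ) fun _ i => p i]
  simp [hp]

/-- Likelihood-ratio identity: the factor p (x t) has derivative 1{x t = i} − p (x t), and dividing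
by the factor and summing over t produces the score. -/
theorem hasDerivAt_seqProb {m L : ℕ} {p : Fin m → ℝ} (hp : ∀ i, 0 < p i) (i : Fin m)
    (x : Fin L → Fin m) :
    HasDerivAt (fun t : ℝ => seqProb ((1 - t) • p + t • Pi.single i (1 : ℝ)) x)
      (seqProb p x * score i x p) 0 := by
  have h1 : ∀ j : Fin L, HasDerivAt
      (fun t : ℝ => ((1 - t) • p + t • Pi.single i (1 : ℝ) : Fin m → ℝ) (x j))
      ((if x j = i then 1 else 0) - p (x j)) 0 := by
    intro j
    have h := (((hasDerivAt_id (0 : ℝ)).const_sub 1).mul_const (p (x j))).add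
      ((hasDerivAt_id (0 : ℝ)).mul_const ((Pi.single i (1 : ℝ) : Fin m → ℝ) (x j)))
    refine h.congr_deriv ?_
    rw [Pi.single_apply]
    ring
  have h2 := HasDerivAt.fun_finsetProd (u := Finset.univ) fun j _ => h1 j
  refine h2.congr_deriv ?_
  symm
  simp only [score, mul_sub, Finset.mul_sum]
  simp only [sub_zero, one_smul, zero_smul, add_zero, smul_eq_mul, mul_sub, Finset.sum_sub_distrib]
  congr 1
  · refine Finset.sum_congr rfl fun j _ => ?_
    rw [seqProb, ← Finset.mul_prod_erase _ _ (Finset.mem_univ j)]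
    split_ifs with hj
    · rw [hj]; have := (hp i).ne'; field_simp
    · simp
  · have : ∀ j ∈ (Finset.univ : Finset (Fin L)),
        (∏ k ∈ Finset.univ.erase j, p (x k)) * p (x j) = seqProb p x := fun j hj => by
      rw [mul_comm, Finset.mul_prod_erase Finset.univ (fun k => p (x k)) hj, seqProb]
    rw [Finset.sum_congr rfl this]
    simp [mul_comm]

theorem abs_score_le {m L : ℕ} {ε : ℝ} (hε : 0 < ε) {p : Fin m → ℝ} (hp : ∀ i, ε ≤ p i)
    (i : Fin m) (x : Fin L → Fin m) : |score i x p| ≤ L / ε + L := by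
  have h0 : 0 ≤ ∑ t, (if x t = i then 1 / p i else 0) := Finset.sum_nonneg fun t _ => by
    have := hε.trans_le (hp i)
    split_ifs <;> positivity
  have h1 : ∑ t, (if x t = i then 1 / p i else 0) ≤ L / ε := by
    have : ∀ t ∈ (Finset.univ : Finset (Fin L)), (if x t = i then 1 / p i else 0) ≤ 1 / ε :=
      fun t _ => by
        split_ifs
        · exact one_div_le_one_div_of_le hε (hp i)
        · positivity
    refine (Finset.sum_le_sum this).trans (le_of_eq ?_)
    simp [div_eq_mul_inv]
  have : (0 : ℝ) ≤ L := Nat.cast_nonneg L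
  rw [score, abs_le]
  constructor <;> linarith

theorem continuousOn_score {m L : ℕ} {ε : ℝ} (hε : 0 < ε) (i : Fin m) (x : Fin L → Fin m) :
    ContinuousOn (fun p => score i x p) (restrictedSimplex m ε) := by
  have : ContinuousOn (fun p : Fin m → ℝ => 1 / p i) (restrictedSimplex m ε) :=
    continuousOn_const.div (continuous_apply i).continuousOn fun p hp =>
      (restrictedSimplex_pos hε hp i).ne'
  refine ContinuousOn.sub (continuousOn_finsetSum _ fun t _ => ?_) continuousOn_const
  split_ifs
  · exact this
  · exact continuousOn_const

theorem continuous_seqProb {m L : ℕ} (x : Fin L → Fin m) :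
    Continuous fun p : Fin m → ℝ => seqProb p x :=
  continuous_finsetProd _ fun t _ => continuous_apply (x t)

-- Gradients of the target quantity and of the penalty.

namespace Model

variable {𝒳 : Type*} (P : Model 𝒳)

/-- The score-function form `E_p[f(X) S_i(X; p)]` of the gradient of `E_p[f(X)]`. -/
noncomputable def scoreMean {L : ℕ} (f : (Fin L → 𝒳) → ℝ) (p : Fin P.m → ℝ) (i : Fin P.m) : ℝ :=
  ∑ x : Fin L → Fin P.m, seqProb p x * (f (P.input x) * score i x p)

theorem hasDerivAt_expect {L : ℕ} (f : (Fin L → 𝒳) → ℝ) {p : Fin P.m → ℝ} (hp : ∀ i, 0 < p i)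
    (i : Fin P.m) :
    HasDerivAt (fun t : ℝ => P.expect ((1 - t) • p + t • Pi.single i (1 : ℝ)) f)
      (P.scoreMean f p i) 0 := by
  have := HasDerivAt.fun_sum (u := Finset.univ) fun x _ =>
    (hasDerivAt_seqProb (L := L) hp i x).mul_const (f (P.input x))
  refine this.congr_deriv ?_
  exact Finset.sum_congr rfl fun x _ => by ring

theorem continuous_expect {L : ℕ} (f : (Fin L → 𝒳) → ℝ) : Continuous fun p => P.expect p f :=
  continuous_finsetSum _ fun x _ => (continuous_seqProb x).mul continuous_const

theorem continuousOn_scoreMean {L : ℕ} (f : (Fin L → 𝒳) → ℝ) {ε : ℝ} (hε : 0 < ε) (i : Fin P.m) :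
    ContinuousOn (fun p => P.scoreMean f p i) (restrictedSimplex P.m ε) :=
  continuousOn_finsetSum _ fun x _ => (continuous_seqProb x).continuousOn.mul
    (continuousOn_const.mul (continuousOn_score hε i x))

/-- The signed excess of `u` over the `j`-th band. -/
noncomputable def excess (j : Fin P.n) (u : ℝ) : ℝ := u - P.proj j u

variable {P} in
theorem abs_excess_sub_le {j : Fin P.n} (hj : P.lo j ≤ P.hi j) (u v : ℝ) :
    |P.excess j u - P.excess j v| ≤ |u - v| := by
  have key : ∀ u v, P.excess j u - P.excess j v ≤ |u - v| := fun u v => by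
    have h1 := le_abs_self (u - v)
    have h2 := abs_nonneg (u - v)
    unfold excess proj
    split_ifs <;> linarith
  rw [abs_le]
  have := key v u
  rw [abs_sub_comm v u] at this
  exact ⟨by linarith, key u v⟩

variable {P} in
-- The projection has kinks at the ends of the band, but the squared distance to an interval is
-- convex and lies below its tangent plus (v − u)², so it is differentiable everywhere.
theorem hasDerivAt_excess_sq {j : Fin P.n} (hj : P.lo j ≤ P.hi j) (u : ℝ) :
    HasDerivAt (fun u => (u - P.proj j u) ^ 2) (2 * P.excess j u) u := by
  refine hasDerivAt_of_sq_bound fun v => ?_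
  have h1 : P.excess j u ^ 2 + 2 * P.excess j u * (v - u) ≤ P.excess j v ^ 2 := by
    unfold excess proj
    split_ifs <;> nlinarith [sq_nonneg (v - u)]
  have h2 : P.excess j v ^ 2 ≤ P.excess j u ^ 2 + 2 * P.excess j u * (v - u) + (v - u) ^ 2 := by
    unfold excess proj
    split_ifs <;> nlinarith [sq_nonneg (v - u)]
  unfold excess at *
  rw [abs_le]
  constructor <;> nlinarith [sq_nonneg (v - u)]

variable {P} in
theorem excess_eq_zero_iff {j : Fin P.n} (u : ℝ) :
    P.excess j u = 0 ↔ P.lo j ≤ u ∧ u ≤ P.hi j := by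
  unfold excess proj
  split_ifs
  · constructor
    · intro; linarith
    · rintro ⟨_, _⟩; linarith
  · constructor
    · intro; linarith
    · rintro ⟨_, _⟩; linarith
  · simp only [sub_self, true_iff]
    constructor <;> linarith

theorem gradPsi_eq {p : Fin P.m → ℝ} (hp : ∀ i, 0 < p i) (i : Fin P.m) :
    P.gradPsi p i = P.scoreMean P.g p i :=
  gateaux_eq_of_hasDerivAt (P.hasDerivAt_expect P.g hp i)

variable {P} in
theorem gradPenalty_eq (hj : ∀ j, P.lo j ≤ P.hi j) {p : Fin P.m → ℝ} (hp : ∀ i, 0 < p i)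
    (i : Fin P.m) :
    P.gradPenalty p i = 2 * ∑ j, P.excess j (P.outProb j p) * P.scoreMean (P.below j) p i := by
  apply gateaux_eq_of_hasDerivAt
  have h0 : ((1 - (0 : ℝ)) • p + (0 : ℝ) • Pi.single i (1 : ℝ) : Fin P.m → ℝ) = p := by simp
  have := HasDerivAt.fun_sum (u := Finset.univ) fun j _ =>
    HasDerivAt.comp (0 : ℝ) (hasDerivAt_excess_sq (hj j)
      (P.outProb j ((1 - (0 : ℝ)) • p + (0 : ℝ) • Pi.single i (1 : ℝ))))
      (P.hasDerivAt_expect (P.below j) hp i)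
  rw [h0] at this
  refine this.congr_deriv ?_
  rw [Finset.mul_sum]
  exact Finset.sum_congr rfl fun x _ => by ring

theorem continuousOn_gradPsi {ε : ℝ} (hε : 0 < ε) :
    ContinuousOn P.gradPsi (restrictedSimplex P.m ε) :=
  continuousOn_pi.2 fun i => (P.continuousOn_scoreMean P.g hε i).congr fun _ hp =>
    P.gradPsi_eq (restrictedSimplex_pos hε hp) i

variable {P} in
theorem continuous_excess {j : Fin P.n} (hj : P.lo j ≤ P.hi j) : Continuous (P.excess j) :=
  (LipschitzWith.of_dist_le_mul (K := 1) fun u v => by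
    simpa [Real.dist_eq] using abs_excess_sub_le hj u v).continuous

variable {P} in
theorem continuousOn_gradPenalty (hj : ∀ j, P.lo j ≤ P.hi j) {ε : ℝ} (hε : 0 < ε) :
    ContinuousOn P.gradPenalty (restrictedSimplex P.m ε) := by
  refine continuousOn_pi.2 fun i => ContinuousOn.congr (f := fun p =>
    2 * ∑ j, P.excess j (P.outProb j p) * P.scoreMean (P.below j) p i) ?_ fun _ hp =>
      gradPenalty_eq hj (restrictedSimplex_pos hε hp) i
  exact continuousOn_const.mul <| continuousOn_finsetSum _ fun j _ =>
    ((continuous_excess (hj j)).comp (P.continuous_expect _)).continuousOn.mul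
      (P.continuousOn_scoreMean _ hε i)

variable {P} in
theorem gradPenalty_eq_zero (hj : ∀ j, P.lo j ≤ P.hi j) {ε : ℝ} (hε : 0 < ε) {p : Fin P.m → ℝ}
    (hp : p ∈ P.feasible ε) : P.gradPenalty p = 0 := by
  funext i
  rw [gradPenalty_eq hj (restrictedSimplex_pos hε hp.1)]
  simp [(excess_eq_zero_iff _).2 (hp.2 _)]

variable {P} in
-- Feasibility of `pstar` makes every band nonempty whatever the sign of `q`; the Lipschitz and
-- smoothness properties of the excess rest on this.
theorem ConstrainedCond.lo_le_hi {ε : ℝ} {pstar : Fin P.m → ℝ} (h : P.ConstrainedCond ε pstar)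
    (j : Fin P.n) : P.lo j ≤ P.hi j :=
  (h.1.1.2 j).1.trans (h.1.1.2 j).2

end Model

-- Lower bound for the drift away from `pstar`.

theorem abs_dotProduct_le {m : ℕ} (a b : Fin m → ℝ) : |a ⬝ᵥ b| ≤ m * ‖a‖ * ‖b‖ := by
  refine (Finset.abs_sum_le_sum_abs _ _).trans ?_
  have : ∀ i ∈ (Finset.univ : Finset (Fin m)), |a i * b i| ≤ ‖a‖ * ‖b‖ := fun i _ => by
    rw [abs_mul]
    exact mul_le_mul (norm_le_pi_norm a i) (norm_le_pi_norm b i) (abs_nonneg _) (norm_nonneg _)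
  refine (Finset.sum_le_sum this).trans (le_of_eq ?_)
  simp [mul_assoc]

/-- Away from `pstar`, the drift of the penalized problem is at least of the order of the penalty
coefficient. -/
theorem exists_drift_ge {𝒳 : Type*} {P : Model 𝒳} {ε : ℝ} (hε : 0 < ε) {pstar : Fin P.m → ℝ}
    (hA1 : P.ConstrainedCond ε pstar) {path : ℝ → Fin P.m → ℝ} (hA3 : P.PathRateCond pstar path)
    {δ : ℝ} (hδ : 0 < δ) :
    ∃ c > 0, ∀ᶠ l in 𝓝[>] (0 : ℝ), ∀ p ∈ restrictedSimplex P.m ε, δ ≤ ‖p - pstar‖ →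
      c * l ≤ (l • P.gradPsi p + P.gradPenalty p) ⬝ᵥ (p - path l) := by
  have hj := hA1.lo_le_hi
  obtain ⟨B, hB⟩ := hA3.bound
  obtain ⟨CΨ, hCΨ⟩ := (isCompact_restrictedSimplex hε).exists_bound_of_continuousOn
    (P.continuousOn_gradPsi hε)
  set s := {p ∈ restrictedSimplex P.m ε | δ ≤ ‖p - pstar‖} with hs
  have hsK : IsCompact s := (isCompact_restrictedSimplex hε).inter_right
    (isClosed_le continuous_const (continuous_id.sub continuous_const).norm)
  have hss : s ⊆ restrictedSimplex P.m ε := fun _ h => h.1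
  have hB0 : 0 ≤ |B| := abs_nonneg B
  -- The subtracted term, times l, bounds the cost of replacing `path l` by `pstar` in the penalty
  -- part, where ‖path l − pstar‖ ≤ |B| l.
  set H : (Fin P.m → ℝ) → ℝ := fun p =>
    P.gradPsi p ⬝ᵥ (p - pstar) - P.m * |B| * ‖P.gradPenalty p‖ with hH
  set a : (Fin P.m → ℝ) → ℝ := fun p => P.gradPenalty p ⬝ᵥ (p - pstar) with ha
  have cdot : ∀ f : (Fin P.m → ℝ) → Fin P.m → ℝ, ContinuousOn f s →
      ContinuousOn (fun p => f p ⬝ᵥ (p - pstar)) s := fun f hf =>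
    continuousOn_finsetSum _ fun i _ => ((continuous_apply i).comp_continuousOn hf).mul
      (by fun_prop)
  have hΨc := (P.continuousOn_gradPsi hε).mono hss
  have hφc := (Model.continuousOn_gradPenalty hj hε).mono hss
  have hHc : ContinuousOn H s := (cdot _ hΨc).sub (continuousOn_const.mul hφc.norm)
  have hac : ContinuousOn a s := cdot _ hφc
  have hpos : ∀ p ∈ s, (0 < H p ∧ 0 ≤ a p) ∨ 0 < a p := fun p hp => by
    by_cases hf : p ∈ P.feasible ε
    · left
      have hz := Model.gradPenalty_eq_zero hj hε hf
      simp only [hH, ha, hz, norm_zero, mul_zero, sub_zero, zero_dotProduct, le_refl, and_true]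
      refine hA1.2.1 p hf fun h => ?_
      have := hp.2
      rw [h, sub_self, norm_zero] at this
      linarith
    · exact Or.inr (hA1.2.2 p hp.1 hf)
  have ha0 : ∀ p ∈ s, 0 ≤ a p := fun p hp => (hpos p hp).elim (·.2) (·.le)
  -- One N serves all of s: otherwise points x N with H + N·a ≤ 0 accumulate at some p, where H +
  -- K·a > 0 for a suitable K. By continuity and a ≥ 0 this contradicts the choice of x far along
  -- the subsequence.
  obtain ⟨N, c, hc, hN⟩ : ∃ N : ℕ, ∃ c > 0, ∀ p ∈ s, c ≤ H p + N * a p := by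
    rcases s.eq_empty_or_nonempty with he | hne
    · exact ⟨0, 1, one_pos, by simp [he]⟩
    have hcN : ∀ N : ℕ, ContinuousOn (fun p => H p + N * a p) s := fun N =>
      hHc.add (continuousOn_const.mul hac)
    suffices ∃ N : ℕ, ∀ p ∈ s, 0 < H p + N * a p by
      obtain ⟨N, hN⟩ := this
      obtain ⟨p₀, hp₀, hmin⟩ := hsK.exists_isMinOn hne (hcN N)
      exact ⟨N, _, hN p₀ hp₀, fun p hp => hmin hp⟩
    by_contra! hcon
    choose x hxs hx using hcon
    obtain ⟨p, hp, φ, hφ, hlim⟩ := hsK.tendsto_subseq hxs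
    have hlim' : Tendsto (x ∘ φ) atTop (𝓝[s] p) :=
      tendsto_nhdsWithin_iff.2 ⟨hlim, Eventually.of_forall fun n => hxs _⟩
    have hK : ∃ K : ℕ, 0 < H p + K * a p := by
      rcases hpos p hp with h | h
      · exact ⟨0, by simpa using h.1⟩
      · obtain ⟨K, hK⟩ := exists_nat_gt (-H p / a p)
        rw [div_lt_iff₀ h] at hK
        exact ⟨K, by linarith⟩
    obtain ⟨K, hK⟩ := hK
    have hev := ((hcN K p hp).tendsto.comp hlim').eventually (lt_mem_nhds hK)
    obtain ⟨n, hn, hn'⟩ := (hev.and (eventually_ge_atTop K)).exists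
    have h1 : (K : ℝ) ≤ φ n := by exact_mod_cast hn'.trans (hφ.id_le n)
    have h2 := ha0 _ (hxs (φ n))
    have h3 := hx (φ n)
    simp only [Function.comp_apply] at hn
    nlinarith
  set D := (P.m : ℝ) * |CΨ| * |B| with hD
  have hD0 : 0 ≤ D := by positivity
  refine ⟨c / 2, by positivity, ?_⟩
  have hsmall : ∀ᶠ l in 𝓝[>] (0 : ℝ), l * (N : ℝ) ≤ 1 ∧ D * l ≤ c / 2 := by
    apply nhdsWithin_le_nhds
    have t1 : Tendsto (fun l : ℝ => l * (N : ℝ)) (𝓝 0) (𝓝 0) :=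
      (continuous_id.mul continuous_const).tendsto' 0 0 (by simp)
    have t2 : Tendsto (fun l : ℝ => D * l) (𝓝 0) (𝓝 0) :=
      (continuous_const.mul continuous_id).tendsto' 0 0 (by simp)
    exact (t1.eventually (ge_mem_nhds one_pos)).and (t2.eventually (ge_mem_nhds (by positivity)))
  filter_upwards [hB, hsmall, self_mem_nhdsWithin] with l hl ⟨hl1, hl2⟩ hl0 p hp hpδ
  have hl0 : 0 < l := hl0
  have hps : p ∈ s := ⟨hp, hpδ⟩
  rw [Real.norm_eq_abs, abs_of_pos hl0] at hl
  have hl' : ‖path l - pstar‖ ≤ |B| * l := hl.trans (by gcongr; exact le_abs_self B)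
  have e : (l • P.gradPsi p + P.gradPenalty p) ⬝ᵥ (p - path l) =
      l * (P.gradPsi p ⬝ᵥ (p - pstar)) + a p - l * (P.gradPsi p ⬝ᵥ (path l - pstar))
        - P.gradPenalty p ⬝ᵥ (path l - pstar) := by
    have : p - path l = (p - pstar) - (path l - pstar) := by abel
    rw [this, dotProduct_sub, add_dotProduct, add_dotProduct, smul_dotProduct, smul_dotProduct,
      smul_eq_mul, smul_eq_mul]
    ring
  have b1 : P.gradPsi p ⬝ᵥ (path l - pstar) ≤ D * l := by
    refine (le_abs_self _).trans ((abs_dotProduct_le _ _).trans ?_)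
    have := (hCΨ p hp).trans (le_abs_self CΨ)
    calc (P.m : ℝ) * ‖P.gradPsi p‖ * ‖path l - pstar‖ ≤ P.m * |CΨ| * (|B| * l) := by gcongr
      _ = D * l := by rw [hD]; ring
  have b2 : P.gradPenalty p ⬝ᵥ (path l - pstar) ≤ l * (P.m * |B| * ‖P.gradPenalty p‖) := by
    refine (le_abs_self _).trans ((abs_dotProduct_le _ _).trans ?_)
    calc (P.m : ℝ) * ‖P.gradPenalty p‖ * ‖path l - pstar‖
        ≤ P.m * ‖P.gradPenalty p‖ * (|B| * l) := by gcongr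
      _ = _ := by ring
  have hc' := hN p hps
  -- Once l·N ≤ 1, the unscaled penalty drift dominates its l·N multiple, which yields l·(H + N·a) ≥
  -- l·c; half of this survives the O(l²) error from Ψ.
  have h5 : l * (N * a p) ≤ a p := by
    nlinarith [ha0 p hps, mul_le_mul_of_nonneg_right hl1 (ha0 p hps)]
  have h6 : l * c ≤ l * H p + a p := by nlinarith
  have h7 : l * (P.gradPsi p ⬝ᵥ (path l - pstar)) ≤ l * (c / 2) :=
    mul_le_mul_of_nonneg_left (b1.trans hl2) hl0.le
  rw [e]
  simp only [hH] at h6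
  linarith

-- Expectations over i.i.d. batches as finite weighted sums.

section ProductWeights

variable {α : Type*} [Fintype α] {M : ℕ}

theorem sum_prod_pi (F : Fin M → α → ℝ) : ∑ x : Fin M → α, ∏ r, F r (x r) = ∏ r, ∑ a, F r a := by
  classical
  rw [← Fintype.piFinset_univ, ← Finset.prod_univ_sum (fun _ => Finset.univ) F]

theorem sum_prod_weight {w : α → ℝ} (hw : ∑ a, w a = 1) : ∑ x : Fin M → α, ∏ r, w (x r) = 1 := by
  rw [sum_prod_pi fun _ => w]; simp [hw]

theorem sum_prod_weight_mul {w : α → ℝ} (hw : ∑ a, w a = 1) (f : α → ℝ) (r₀ : Fin M) :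
    ∑ x : Fin M → α, (∏ r, w (x r)) * f (x r₀) = ∑ a, w a * f a := by
  have h := sum_prod_pi fun (r : Fin M) a => w a * if r = r₀ then f a else 1
  simp only [Finset.prod_mul_distrib, Finset.prod_ite_eq', Finset.mem_univ, if_true] at h
  rw [h, Finset.prod_eq_single r₀ (fun r _ hr => by simp [hr, hw]) (by simp)]
  simp

/-- Independence of distinct draws: f and g are inserted into two different factors of the product
and every other factor sums to one. -/
theorem sum_prod_weight_mul_mul {w : α → ℝ} (hw : ∑ a, w a = 1) (f g : α → ℝ)
    {r₀ r₁ : Fin M} (hr : r₀ ≠ r₁) :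
    ∑ x : Fin M → α, (∏ r, w (x r)) * (f (x r₀) * g (x r₁)) =
      (∑ a, w a * f a) * ∑ a, w a * g a := by
  have h := sum_prod_pi fun (r : Fin M) a =>
    w a * ((if r = r₀ then f a else 1) * if r = r₁ then g a else 1)
  simp only [Finset.prod_mul_distrib, Finset.prod_ite_eq', Finset.mem_univ, if_true] at h
  rw [h, Finset.prod_eq_mul r₀ r₁ hr (fun r _ h => by simp [h.1, h.2, hw]) (by simp) (by simp)]
  simp [hr, hr.symm]

theorem sum_prod_weight_mean {w : α → ℝ} (hw : ∑ a, w a = 1) (hM : 1 ≤ M) (f : α → ℝ) :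
    ∑ x : Fin M → α, (∏ r, w (x r)) * (1 / (M : ℝ) * ∑ r, f (x r)) = ∑ a, w a * f a := by
  have hM' : (M : ℝ) ≠ 0 := by positivity
  simp only [Finset.mul_sum]
  rw [Finset.sum_comm]
  have : ∀ r ∈ (Finset.univ : Finset (Fin M)),
      ∑ x : Fin M → α, (∏ r, w (x r)) * (1 / (M : ℝ) * f (x r)) =
        1 / (M : ℝ) * ∑ a, w a * f a := fun r _ => by
    rw [← sum_prod_weight_mul hw f r, Finset.mul_sum]
    exact Finset.sum_congr rfl fun x _ => by ring
  rw [Finset.sum_congr rfl this]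
  simp [hM']

/-- The mean absolute error of a batch mean of `[0, 1]`-valued terms. -/
theorem sum_prod_weight_abs_mean_sub_le {w : α → ℝ} (hw : ∑ a, w a = 1) (hM : 1 ≤ M)
    (hw0 : ∀ a, 0 ≤ w a) {f : α → ℝ} (hf0 : ∀ a, 0 ≤ f a) (hf1 : ∀ a, f a ≤ 1) :
    ∑ x : Fin M → α, (∏ r, w (x r)) * |1 / (M : ℝ) * ∑ r, f (x r) - ∑ a, w a * f a| ≤
      1 / √(M : ℝ) := by
  have hM' : (0 : ℝ) < M := by positivity
  set F := ∑ a, w a * f a with hF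
  have hF0 : 0 ≤ F := Finset.sum_nonneg fun a _ => mul_nonneg (hw0 a) (hf0 a)
  have hF1 : F ≤ 1 := by
    rw [← hw]
    exact Finset.sum_le_sum fun a _ => mul_le_of_le_one_right (hw0 a) (hf1 a)
  set h : α → ℝ := fun a => f a - F with hh
  have hmean : ∑ a, w a * h a = 0 := by
    simp only [hh, mul_sub, Finset.sum_sub_distrib, ← Finset.sum_mul, hw]
    simp [hF]
  have herr : ∀ x : Fin M → α, 1 / (M : ℝ) * ∑ r, f (x r) - F = 1 / (M : ℝ) * ∑ r, h (x r) := by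
    intro x
    simp only [hh, Finset.sum_sub_distrib, Finset.sum_const, Finset.card_univ, Fintype.card_fin,
      nsmul_eq_mul]
    field_simp
  -- Cross terms vanish by independence and centering, and each of the M diagonal terms is at most
  -- 1.
  have hsq : ∑ x : Fin M → α, (∏ r, w (x r)) * (∑ r, h (x r)) ^ 2 ≤ M := by
    have hexp : ∀ x : Fin M → α, (∏ r, w (x r)) * (∑ r, h (x r)) ^ 2 =
        ∑ r, ∑ r', (∏ r, w (x r)) * (h (x r) * h (x r')) := fun x => by
      rw [sq, Finset.sum_mul_sum]
      simp only [Finset.mul_sum]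
    simp only [hexp]
    rw [Finset.sum_comm]
    have : ∀ r ∈ (Finset.univ : Finset (Fin M)),
        ∑ x : Fin M → α, ∑ r', (∏ r, w (x r)) * (h (x r) * h (x r')) ≤ 1 := fun r _ => by
      rw [Finset.sum_comm, Finset.sum_eq_single r]
      · rw [sum_prod_weight_mul hw (fun a => h a * h a) r, ← hw]
        refine Finset.sum_le_sum fun a _ => mul_le_of_le_one_right (hw0 a) ?_
        have h0 := hf0 a
        have h1 := hf1 a
        simp only [hh]
        nlinarith
      · intro r' _ hr
        rw [sum_prod_weight_mul_mul hw h h hr.symm, hmean, zero_mul]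
      · simp
    refine (Finset.sum_le_sum this).trans ?_
    simp
  have hs : 0 < √(M : ℝ) := Real.sqrt_pos.2 hM'
  have hss : √(M : ℝ) ^ 2 = M := Real.sq_sqrt hM'.le
  -- AM-GM in place of Cauchy-Schwarz, weighted so that each of the two terms contributes at most
  -- 1/(2√M) after averaging.
  have hpt : ∀ x : Fin M → α, (∏ r, w (x r)) * |1 / (M : ℝ) * ∑ r, f (x r) - F| ≤
      1 / (2 * √(M : ℝ) ^ 3) * ((∏ r, w (x r)) * (∑ r, h (x r)) ^ 2) +
        1 / (2 * √(M : ℝ)) * ∏ r, w (x r) := by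
    intro x
    rw [herr, abs_mul, abs_of_pos (by positivity : 0 < 1 / (M : ℝ))]
    nth_rw 1 [← hss]
    set t := ∑ r, h (x r)
    have hp : 0 ≤ ∏ r, w (x r) := Finset.prod_nonneg fun _ _ => hw0 _
    have : 1 / √(M : ℝ) ^ 2 * |t| ≤ 1 / (2 * √(M : ℝ) ^ 3) * t ^ 2 + 1 / (2 * √(M : ℝ)) := by
      rw [← sub_nonneg]
      have : 1 / (2 * √(M : ℝ) ^ 3) * t ^ 2 + 1 / (2 * √(M : ℝ)) - 1 / √(M : ℝ) ^ 2 * |t| =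
          (|t| - √(M : ℝ)) ^ 2 / (2 * √(M : ℝ) ^ 3) := by
        rw [← sq_abs t]
        field_simp
        ring
      rw [this]
      positivity
    nlinarith [mul_le_mul_of_nonneg_left this hp]
  refine (Finset.sum_le_sum fun x _ => hpt x).trans ?_
  rw [Finset.sum_add_distrib, ← Finset.mul_sum, ← Finset.mul_sum, sum_prod_weight hw]
  have h3 : 1 / (2 * √(M : ℝ) ^ 3) * (M : ℝ) = 1 / (2 * √(M : ℝ)) := by
    nth_rw 2 [← hss]
    field_simp
  have h4 := mul_le_mul_of_nonneg_left hsq (by positivity : 0 ≤ 1 / (2 * √(M : ℝ) ^ 3))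
  have h5 : 1 / (2 * √(M : ℝ)) + 1 / (2 * √(M : ℝ)) = 1 / √(M : ℝ) := by field_simp; norm_num
  linarith

end ProductWeights

theorem abs_mean_le {M : ℕ} {f : Fin M → ℝ} {C : ℝ} (hC : 0 ≤ C) (hf : ∀ r, |f r| ≤ C) :
    |1 / (M : ℝ) * ∑ r, f r| ≤ C := by
  have h1 : |∑ r, f r| ≤ M * C := by
    refine (Finset.abs_sum_le_sum_abs _ _).trans ((Finset.sum_le_sum fun r _ => hf r).trans ?_)
    simp
  rw [abs_mul, abs_of_nonneg (by positivity)]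
  rcases Nat.eq_zero_or_pos M with rfl | hM
  · simpa using hC
  · calc 1 / (M : ℝ) * |∑ r, f r| ≤ 1 / (M : ℝ) * (M * C) := by gcongr
      _ = C := by field_simp

-- Bias and size of the gradient estimator.

namespace Model

variable {𝒳 : Type*} (P : Model 𝒳)

theorem below_nonneg (j : Fin P.n) (x : Fin P.T → 𝒳) : 0 ≤ P.below j x :=
  Set.indicator_nonneg (fun _ _ => zero_le_one) _

theorem below_le_one (j : Fin P.n) (x : Fin P.T → 𝒳) : P.below j x ≤ 1 :=
  Set.indicator_le_self' (f := fun _ => (1 : ℝ)) (fun _ _ => zero_le_one) _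

/-- A joint realization of the replications simulated in one iteration. -/
abbrev Sample (M₁ M₂ M₃ : ℕ) : Type :=
  (Fin M₁ → Fin P.T → Fin P.m) × (Fin M₂ → Fin P.T → Fin P.m) × (Fin M₃ → Fin P.S → Fin P.m)

variable {M₁ M₂ M₃ : ℕ}

/-- The probability of a joint realization of the replications under `p`. -/
noncomputable def sampleProb (p : Fin P.m → ℝ) (x : P.Sample M₁ M₂ M₃) : ℝ :=
  (∏ r, seqProb p (x.1 r)) * (∏ r, seqProb p (x.2.1 r)) * ∏ r, seqProb p (x.2.2 r)

/-- The estimated gradient of the penalized objective. -/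
noncomputable def gradHat (l : ℝ) (p : Fin P.m → ℝ) (x : P.Sample M₁ M₂ M₃) (i : Fin P.m) : ℝ :=
  l * P.gradPsiHat p x.2.2 i + P.gradPenaltyHat p x.1 x.2.1 i

variable {P} {p : Fin P.m → ℝ}

theorem sum_sampleProb_mul_fst_snd (hp : ∑ i, p i = 1) (a : (Fin M₁ → Fin P.T → Fin P.m) → ℝ)
    (b : (Fin M₂ → Fin P.T → Fin P.m) → ℝ) :
    ∑ x : P.Sample M₁ M₂ M₃, P.sampleProb p x * (a x.1 * b x.2.1) =
      (∑ x, (∏ r, seqProb p (x r)) * a x) * ∑ x, (∏ r, seqProb p (x r)) * b x := by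
  simp only [sampleProb, Fintype.sum_prod_type]
  rw [Finset.sum_mul_sum]
  refine Finset.sum_congr rfl fun x₁ _ => Finset.sum_congr rfl fun x₂ _ => ?_
  rw [← mul_one ((∏ r, seqProb p (x₁ r)) * a x₁ * _),
    ← sum_prod_weight (M := M₃) (sum_seqProb (L := P.S) hp), Finset.mul_sum]
  exact Finset.sum_congr rfl fun x₃ _ => by ring

theorem sum_sampleProb (hp : ∑ i, p i = 1) : ∑ x : P.Sample M₁ M₂ M₃, P.sampleProb p x = 1 := by
  have := sum_sampleProb_mul_fst_snd (M₁ := M₁) (M₂ := M₂) (M₃ := M₃) hp (fun _ => 1) fun _ => 1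
  simpa [sum_prod_weight (sum_seqProb hp)] using this

theorem sum_sampleProb_mul_thd (hp : ∑ i, p i = 1) (c : (Fin M₃ → Fin P.S → Fin P.m) → ℝ) :
    ∑ x : P.Sample M₁ M₂ M₃, P.sampleProb p x * c x.2.2 = ∑ x, (∏ r, seqProb p (x r)) * c x := by
  simp only [sampleProb, Fintype.sum_prod_type]
  have h1 := sum_prod_weight (M := M₁) (sum_seqProb (L := P.T) hp)
  have h2 := sum_prod_weight (M := M₂) (sum_seqProb (L := P.T) hp)
  simp only [mul_assoc, ← Finset.mul_sum]
  simp only [← Finset.sum_mul, h1, h2, one_mul]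

theorem sum_sampleProb_mul_gradPsiHat (hp : ∑ i, p i = 1) (hM₃ : 1 ≤ M₃) (i : Fin P.m) :
    ∑ x : P.Sample M₁ M₂ M₃, P.sampleProb p x * P.gradPsiHat p x.2.2 i = P.scoreMean P.g p i := by
  rw [sum_sampleProb_mul_thd hp fun x => P.gradPsiHat p x i]
  exact sum_prod_weight_mean (sum_seqProb hp) hM₃ fun x => P.g (P.input x) * score i x p

/-- Independence of the first two batches factorizes each product. The score factor is unbiased, so
only the mean excess can differ from that in `gradPenalty_eq`. -/
theorem sum_sampleProb_mul_gradPenaltyHat (hp : ∑ i, p i = 1) (hM₂ : 1 ≤ M₂) (i : Fin P.m) :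
    ∑ x : P.Sample M₁ M₂ M₃, P.sampleProb p x * P.gradPenaltyHat p x.1 x.2.1 i =
      2 * ∑ j, (∑ x : Fin M₁ → _, (∏ r, seqProb p (x r)) * P.excess j (P.uHat x j)) *
        P.scoreMean (P.below j) p i := by
  have h : ∀ j, (∑ x : Fin M₁ → _, (∏ r, seqProb p (x r)) * P.excess j (P.uHat x j)) *
      P.scoreMean (P.below j) p i = ∑ x : P.Sample M₁ M₂ M₃, P.sampleProb p x *
        (P.excess j (P.uHat x.1 j) *
          (1 / (M₂ : ℝ) * ∑ r, P.below j (P.input (x.2.1 r)) * score i (x.2.1 r) p)) := fun j => by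
    rw [sum_sampleProb_mul_fst_snd hp (fun x => P.excess j (P.uHat x j)) fun x =>
      1 / (M₂ : ℝ) * ∑ r, P.below j (P.input (x r)) * score i (x r) p,
      sum_prod_weight_mean (sum_seqProb hp) hM₂ fun x => P.below j (P.input x) * score i x p]
    rfl
  simp only [h]
  rw [Finset.sum_comm, Finset.mul_sum]
  refine Finset.sum_congr rfl fun x _ => ?_
  rw [← Finset.mul_sum, gradPenaltyHat]
  simp only [excess]
  ring

theorem abs_sum_excess_uHat_sub_le (hp : ∑ i, p i = 1) (hM₁ : 1 ≤ M₁) (hp0 : ∀ i, 0 ≤ p i)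
    {j : Fin P.n} (hj : P.lo j ≤ P.hi j) :
    |(∑ x : Fin M₁ → _, (∏ r, seqProb p (x r)) * P.excess j (P.uHat x j)) -
      P.excess j (P.outProb j p)| ≤ 1 / √(M₁ : ℝ) := by
  have hw := sum_prod_weight (M := M₁) (sum_seqProb (L := P.T) hp)
  have e : P.excess j (P.outProb j p) =
      ∑ x : Fin M₁ → Fin P.T → Fin P.m, (∏ r, seqProb p (x r)) * P.excess j (P.outProb j p) := by
    rw [← Finset.sum_mul, hw, one_mul]
  rw [e, ← Finset.sum_sub_distrib]
  refine (Finset.abs_sum_le_sum_abs _ _).trans ?_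
  refine le_trans (Finset.sum_le_sum fun x _ => ?_) (sum_prod_weight_abs_mean_sub_le
    (sum_seqProb hp) hM₁ (fun x => seqProb_nonneg hp0 x)
    (fun x => P.below_nonneg j (P.input x)) fun x => P.below_le_one j (P.input x))
  rw [← mul_sub, abs_mul, abs_of_nonneg (Finset.prod_nonneg fun r _ => seqProb_nonneg hp0 (x r))]
  exact mul_le_mul_of_nonneg_left (abs_excess_sub_le hj _ _)
    (Finset.prod_nonneg fun r _ => seqProb_nonneg hp0 (x r))

theorem abs_scoreMean_below_le {ε : ℝ} (hε : 0 < ε) (hp : p ∈ restrictedSimplex P.m ε)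
    (j : Fin P.n) (i : Fin P.m) : |P.scoreMean (P.below j) p i| ≤ P.T / ε + P.T := by
  have hC : 0 ≤ (P.T : ℝ) / ε + P.T := by positivity
  refine (Finset.abs_sum_le_sum_abs _ _).trans ?_
  have : ∀ x ∈ (Finset.univ : Finset (Fin P.T → Fin P.m)),
      |seqProb p x * (P.below j (P.input x) * score i x p)| ≤
        seqProb p x * (P.T / ε + P.T) := fun x _ => by
    have h0 := seqProb_nonneg (fun i => (restrictedSimplex_pos hε hp i).le) x
    rw [abs_mul, abs_mul, abs_of_nonneg h0, abs_of_nonneg (P.below_nonneg _ _)]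
    refine mul_le_mul_of_nonneg_left ?_ h0
    calc _ ≤ 1 * (P.T / ε + P.T) := mul_le_mul (P.below_le_one _ _) (abs_score_le hε hp.2 i x)
          (abs_nonneg _) zero_le_one
      _ = _ := one_mul _
  refine (Finset.sum_le_sum this).trans (le_of_eq ?_)
  rw [← Finset.sum_mul, sum_seqProb hp.1, one_mul]

/-- The estimated gradient is biased by at most a multiple of `1 / √M₁`. -/
theorem abs_sum_sampleProb_gradHat_sub_le (hj : ∀ j, P.lo j ≤ P.hi j) {ε : ℝ} (hε : 0 < ε)
    (hp : p ∈ restrictedSimplex P.m ε) (hM₁ : 1 ≤ M₁) (hM₂ : 1 ≤ M₂) (hM₃ : 1 ≤ M₃) (l : ℝ)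
    (i : Fin P.m) :
    |(∑ x : P.Sample M₁ M₂ M₃, P.sampleProb p x * P.gradHat l p x i) -
      (l • P.gradPsi p + P.gradPenalty p) i| ≤ 2 * P.n * (P.T / ε + P.T) * (1 / √(M₁ : ℝ)) := by
  have hpos := restrictedSimplex_pos hε hp
  have e1 : ∑ x : P.Sample M₁ M₂ M₃, P.sampleProb p x * P.gradHat l p x i =
      l * P.scoreMean P.g p i +
        ∑ x : P.Sample M₁ M₂ M₃, P.sampleProb p x * P.gradPenaltyHat p x.1 x.2.1 i := by
    rw [← sum_sampleProb_mul_gradPsiHat (M₁ := M₁) (M₂ := M₂) hp.1 hM₃, Finset.mul_sum,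
      ← Finset.sum_add_distrib]
    exact Finset.sum_congr rfl fun x _ => by rw [gradHat]; ring
  rw [e1, sum_sampleProb_mul_gradPenaltyHat hp.1 hM₂, Pi.add_apply, Pi.smul_apply, smul_eq_mul,
    P.gradPsi_eq hpos, gradPenalty_eq hj hpos, add_sub_add_left_eq_sub, ← mul_sub,
    ← Finset.sum_sub_distrib, abs_mul, abs_two, mul_assoc (2 * (P.n : ℝ)), mul_assoc (2 : ℝ)]
  refine mul_le_mul_of_nonneg_left ?_ zero_le_two
  refine (Finset.abs_sum_le_sum_abs _ _).trans ?_
  have : ∀ j ∈ (Finset.univ : Finset (Fin P.n)),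
      |(∑ x : Fin M₁ → _, (∏ r, seqProb p (x r)) * P.excess j (P.uHat x j)) *
        P.scoreMean (P.below j) p i - P.excess j (P.outProb j p) * P.scoreMean (P.below j) p i| ≤
        (P.T / ε + P.T) * (1 / √(M₁ : ℝ)) := fun j _ => by
    rw [← sub_mul, abs_mul, mul_comm]
    exact mul_le_mul (abs_scoreMean_below_le hε hp j i)
      (abs_sum_excess_uHat_sub_le hp.1 hM₁ (fun i => (hpos i).le) (hj j)) (abs_nonneg _)
      (by positivity)
  refine (Finset.sum_le_sum this).trans (le_of_eq ?_)
  simp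

/-- The estimated gradient is bounded, uniformly in the batch sizes. -/
theorem exists_abs_gradHat_le (hj : ∀ j, P.lo j ≤ P.hi j) {ε : ℝ} (hε : 0 < ε) (l₀ : ℝ) :
    ∃ C, 0 ≤ C ∧ ∀ {M₁ M₂ M₃ : ℕ} (l : ℝ) (p : Fin P.m → ℝ) (x : P.Sample M₁ M₂ M₃) (i : Fin P.m),
      |l| ≤ l₀ → p ∈ restrictedSimplex P.m ε → |P.gradHat l p x i| ≤ C := by
  -- Only finitely many input sequences occur, so this sum bounds |g| on all of them although g
  -- itself is arbitrary.
  set G := ∑ x : Fin P.S → Fin P.m, |P.g (P.input x)| with hG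
  have hG0 : 0 ≤ G := Finset.sum_nonneg fun _ _ => abs_nonneg _
  refine ⟨|l₀| * (G * (P.S / ε + P.S)) + 2 * ∑ j, (|P.excess j 0| + 1) * (P.T / ε + P.T), ?_, ?_⟩
  · positivity
  intro M₁ M₂ M₃ l p x i hl hp
  have h1 : |P.gradPsiHat p x.2.2 i| ≤ G * (P.S / ε + P.S) := by
    refine abs_mean_le (by positivity) fun r => ?_
    rw [abs_mul]
    refine mul_le_mul ?_ (abs_score_le hε hp.2 i _) (abs_nonneg _) hG0
    exact Finset.single_le_sum (f := fun x => |P.g (P.input x)|) (fun _ _ => abs_nonneg _)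
      (Finset.mem_univ (x.2.2 r))
  have h2 : |P.gradPenaltyHat p x.1 x.2.1 i| ≤
      2 * ∑ j, (|P.excess j 0| + 1) * (P.T / ε + P.T) := by
    rw [gradPenaltyHat, abs_mul, abs_two]
    refine mul_le_mul_of_nonneg_left ?_ zero_le_two
    refine (Finset.abs_sum_le_sum_abs _ _).trans (Finset.sum_le_sum fun j _ => ?_)
    rw [abs_mul]
    refine mul_le_mul ?_ ?_ (abs_nonneg _) (by positivity)
    · have hu : |P.uHat x.1 j| ≤ 1 := abs_mean_le zero_le_one fun r => by
        rw [abs_of_nonneg (P.below_nonneg _ _)]; exact P.below_le_one _ _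
      have h3 := abs_excess_sub_le (hj j) (P.uHat x.1 j) 0
      rw [sub_zero] at h3
      have h4 := abs_sub_abs_le_abs_sub (P.excess j (P.uHat x.1 j)) (P.excess j 0)
      change |P.excess j (P.uHat x.1 j)| ≤ _
      linarith
    · refine abs_mean_le (by positivity) fun r => ?_
      rw [abs_mul, abs_of_nonneg (P.below_nonneg _ _)]
      calc _ ≤ 1 * (P.T / ε + P.T) := mul_le_mul (P.below_le_one _ _) (abs_score_le hε hp.2 i _)
            (abs_nonneg _) zero_le_one
        _ = _ := one_mul _
  refine (abs_add_le _ _).trans (add_le_add ?_ h2)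
  rw [abs_mul]
  exact mul_le_mul (hl.trans (le_abs_self _)) h1 (abs_nonneg _) (abs_nonneg _)

theorem continuousOn_gradHat {ε : ℝ} (hε : 0 < ε) (l : ℝ) (x : P.Sample M₁ M₂ M₃) (i : Fin P.m) :
    ContinuousOn (fun p => P.gradHat l p x i) (restrictedSimplex P.m ε) := by
  refine (continuousOn_const.mul (continuousOn_const.mul ?_)).add (continuousOn_const.mul ?_)
  · exact continuousOn_finsetSum _ fun r _ => continuousOn_const.mul (continuousOn_score hε i _)
  · exact continuousOn_finsetSum _ fun j _ => continuousOn_const.mul (continuousOn_const.mul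
      (continuousOn_finsetSum _ fun r _ => continuousOn_const.mul (continuousOn_score hε i _)))

end Model

-- Almost-supermartingales and conditional expectations.

/-- The Robbins-Siegmund convergence theorem, with deterministic perturbations. -/
theorem ae_tendsto_and_summable_of_condExp_le {Ω : Type*} [mΩ : MeasurableSpace Ω] {μ : Measure Ω}
    [IsProbabilityMeasure μ] {ℱ : Filtration ℕ mΩ} {D G : ℕ → Ω → ℝ} {r : ℕ → ℝ}
    (hDm : ∀ n, StronglyMeasurable[ℱ n] (D n)) (hGm : ∀ n, StronglyMeasurable[ℱ n] (G n))
    (hDi : ∀ n, Integrable (D n) μ) (hGi : ∀ n, Integrable (G n) μ)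
    (hD0 : ∀ n ω, 0 ≤ D n ω) (hG0 : ∀ n ω, 0 ≤ G n ω) (hr0 : ∀ n, 0 ≤ r n) (hr : Summable r)
    (h : ∀ n, μ[D (n + 1) | ℱ n] ≤ᵐ[μ] fun ω => D n ω - G n ω + r n) :
    ∀ᵐ ω ∂μ, (∃ c, Tendsto (fun n => D n ω) atTop (𝓝 c)) ∧ Summable fun n => G n ω := by
  set A : ℕ → Ω → ℝ := fun n ω => ∑ j ∈ Finset.range n, (G j ω - r j) with hA
  -- Adding the accumulated G − r compensates the drift: Y is a supermartingale bounded below by −∑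
  -- r, hence bounded in L¹.
  set Y : ℕ → Ω → ℝ := fun n => D n + A n with hY
  -- The compensator is predictable, so `A (n + 1)` passes through the conditional expectation given
  -- ℱ n.
  have hAm' : ∀ n, StronglyMeasurable[ℱ n] (A (n + 1)) := fun n =>
    Finset.stronglyMeasurable_fun_sum _ fun j hj =>
      ((hGm j).mono (ℱ.mono (Nat.lt_succ_iff.1 (Finset.mem_range.1 hj)))).sub
        stronglyMeasurable_const
  have hAm : ∀ n, StronglyMeasurable[ℱ n] (A n) := fun n =>
    Finset.stronglyMeasurable_fun_sum _ fun j hj =>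
      ((hGm j).mono (ℱ.mono (Finset.mem_range.1 hj).le)).sub stronglyMeasurable_const
  have hAi : ∀ n, Integrable (A n) μ := fun n =>
    integrable_finsetSum _ fun j _ => (hGi j).sub (integrable_const _)
  have hYi : ∀ n, Integrable (Y n) μ := fun n => (hDi n).add (hAi n)
  have hsup : Supermartingale Y ℱ μ := by
    refine supermartingale_nat (fun n => (hDm n).add (hAm n)) hYi fun n => ?_
    have h1 := condExp_add (hDi (n + 1)) (hAi (n + 1)) (ℱ n)
    rw [condExp_of_stronglyMeasurable (ℱ.le n) (hAm' n) (hAi (n + 1))] at h1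
    filter_upwards [h1, h n] with ω e1 e2
    have e3 : A (n + 1) ω = A n ω + (G n ω - r n) := Finset.sum_range_succ _ _
    have e4 : (μ[Y (n + 1) | ℱ n]) ω = (μ[D (n + 1) | ℱ n]) ω + A (n + 1) ω := e1
    have e5 : Y n ω = D n ω + A n ω := rfl
    rw [e4, e3, e5]
    linarith
  set R := ∑' n, r n with hR
  have hRle : ∀ n, ∑ j ∈ Finset.range n, r j ≤ R := fun n => hr.sum_le_tsum _ fun j _ => hr0 j
  have hAeq : ∀ n ω, A n ω = ∑ j ∈ Finset.range n, G j ω - ∑ j ∈ Finset.range n, r j := fun n ω =>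
    Finset.sum_sub_distrib _ _
  have hYge : ∀ n ω, -R ≤ Y n ω := fun n ω => by
    have h1 : Y n ω = D n ω + A n ω := rfl
    have h2 : 0 ≤ ∑ j ∈ Finset.range n, G j ω := Finset.sum_nonneg fun j _ => hG0 j ω
    rw [h1, hAeq]
    linarith [hD0 n ω, hRle n]
  have hR0 : 0 ≤ R := tsum_nonneg hr0
  have hnorm : ∀ n, ∫ ω, ‖Y n ω‖ ∂μ ≤ ∫ ω, Y 0 ω ∂μ + 2 * R := fun n => by
    have h1 : ∫ ω, ‖Y n ω‖ ∂μ ≤ ∫ ω, (Y n ω + 2 * R) ∂μ :=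
      integral_mono (hYi n).norm ((hYi n).add (integrable_const _)) fun ω => by
        have := hYge n ω
        change |Y n ω| ≤ Y n ω + 2 * R
        rw [abs_le]
        constructor <;> linarith
    rw [integral_add (hYi n) (integrable_const _)] at h1
    have h2 := hsup.setIntegral_le (Nat.zero_le n) MeasurableSet.univ
    simp only [Measure.restrict_univ] at h2
    simp only [integral_const, probReal_univ, smul_eq_mul, one_mul] at h1
    linarith
  have hbdd : ∀ n, eLpNorm ((-Y) n) 1 μ ≤ (Real.toNNReal (∫ ω, Y 0 ω ∂μ + 2 * R)) := fun n => by
    rw [Pi.neg_apply, eLpNorm_neg, eLpNorm_one_eq_lintegral_enorm,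
      ← ofReal_integral_norm_eq_lintegral_enorm (hYi n)]
    exact ENNReal.ofReal_le_ofReal (hnorm n)
  filter_upwards [hsup.neg.exists_ae_tendsto_of_bdd hbdd] with ω hω
  obtain ⟨c, hc⟩ := hω
  have hZ : Tendsto (fun n => D n ω + ∑ j ∈ Finset.range n, G j ω) atTop (𝓝 (-c + R)) := by
    refine (hc.neg.add hr.hasSum.tendsto_sum_nat).congr fun n => ?_
    have h1 : (-Y) n ω = -(D n ω + A n ω) := rfl
    rw [h1, hAeq]
    ring
  obtain ⟨B, hB⟩ := hZ.bddAbove_range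
  have hG : Summable fun n => G n ω := by
    refine summable_of_sum_range_le (c := B) (fun n => hG0 n ω) fun n => ?_
    have := hB ⟨n, rfl⟩
    have h2 := hD0 n ω
    simp only at this
    linarith
  refine ⟨⟨_, (hZ.sub hG.hasSum.tendsto_sum_nat).congr fun n => ?_⟩, hG⟩
  ring

/-- Conditional expectation of a function of a finite-valued random variable and of quantities that
are known at the conditioning time. -/
theorem condExp_comp_finite {Ω α : Type*} [Fintype α] {m₀ mΩ : MeasurableSpace Ω} {μ : Measure Ω}
    [IsProbabilityMeasure μ] (hm : m₀ ≤ mΩ) {Z : Ω → α} (hZ : ∀ a, MeasurableSet {ω | Z ω = a})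
    {π : α → Ω → ℝ} (hπ : ∀ a, μ[Set.indicator {ω | Z ω = a} (fun _ => (1 : ℝ)) | m₀] =ᵐ[μ] π a)
    {F : α → Ω → ℝ} (hF : ∀ a, StronglyMeasurable[m₀] (F a)) {C : ℝ} (hC : ∀ a ω, |F a ω| ≤ C) :
    Integrable (fun ω => F (Z ω) ω) μ ∧
      μ[fun ω => F (Z ω) ω | m₀] =ᵐ[μ] fun ω => ∑ a, π a ω * F a ω := by
  classical
  set I : α → Ω → ℝ := fun a => Set.indicator {ω | Z ω = a} fun _ => (1 : ℝ) with hI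
  have heq : (fun ω => F (Z ω) ω) = ∑ a, F a * I a := by
    funext ω
    rw [Finset.sum_apply, Finset.sum_eq_single (Z ω)]
    · simp [hI]
    · intro a _ ha
      simp [hI, ha.symm]
    · simp
  have hIi : ∀ a, Integrable (I a) μ := fun a => (integrable_const 1).indicator (hZ a)
  have hFI : ∀ a, Integrable (F a * I a) μ := fun a =>
    (hIi a).bdd_mul ((hF a).mono hm).aestronglyMeasurable (Eventually.of_forall (hC a))
  have hint : Integrable (∑ a, F a * I a) μ := integrable_finsetSum' _ fun a _ => hFI a
  rw [heq]
  refine ⟨hint, ?_⟩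
  have h1 := condExp_finsetSum (s := Finset.univ) (fun a _ => hFI a) m₀
  have h2 : ∀ a, μ[F a * I a | m₀] =ᵐ[μ] F a * μ[I a | m₀] := fun a =>
    condExp_mul_of_stronglyMeasurable_left (hF a) (hFI a) (hIi a)
  filter_upwards [h1, ae_all_iff.2 h2, ae_all_iff.2 hπ] with ω e1 e2 e3
  rw [e1, Finset.sum_apply]
  refine Finset.sum_congr rfl fun a _ => ?_
  rw [e2, Pi.mul_apply, e3, mul_comm]

/-- A function that is continuous on the simplex, evaluated at a random point of the simplex. -/
theorem stronglyMeasurable_comp_simplex {Ω : Type*} {m : ℕ} {ε : ℝ} {m₀ : MeasurableSpace Ω}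
    {p : Ω → Fin m → ℝ} (hp : Measurable[m₀] p) (hps : ∀ ω, p ω ∈ restrictedSimplex m ε)
    {f : (Fin m → ℝ) → ℝ} (hf : ContinuousOn f (restrictedSimplex m ε)) :
    StronglyMeasurable[m₀] fun ω => f (p ω) := by
  -- f is controlled on the simplex only, so measurability is obtained by factoring p through the
  -- subtype.
  have h1 := (continuousOn_iff_continuous_domRestrict.1 hf).measurable
  exact (h1.comp (hp.subtype_mk (h := hps))).stronglyMeasurable

theorem integrable_comp_simplex {Ω : Type*} {mΩ : MeasurableSpace Ω} {μ : Measure Ω}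
    [IsProbabilityMeasure μ] {m : ℕ} {ε : ℝ} (hε : 0 < ε)
    {p : Ω → Fin m → ℝ} (hp : Measurable p) (hps : ∀ ω, p ω ∈ restrictedSimplex m ε)
    {f : (Fin m → ℝ) → ℝ} (hf : ContinuousOn f (restrictedSimplex m ε)) :
    Integrable (fun ω => f (p ω)) μ := by
  obtain ⟨C, hC⟩ := (isCompact_restrictedSimplex hε).exists_bound_of_continuousOn hf
  exact Integrable.of_bound (stronglyMeasurable_comp_simplex hp hps hf).aestronglyMeasurable C
    (Eventually.of_forall fun ω => hC _ (hps ω))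

theorem continuousOn_klDivSum {m : ℕ} {ε : ℝ} (hε : 0 < ε) (q : Fin m → ℝ) :
    ContinuousOn (klDivSum q) (restrictedSimplex m ε) :=
  continuousOn_finsetSum _ fun i _ => continuousOn_const.mul <| continuousOn_const.sub <|
    (continuous_apply i).continuousOn.log fun _ hp => (restrictedSimplex_pos hε hp i).ne'

-- The one-step drift inequality of the algorithm.

section Run

variable {𝒳 Ω : Type*} [mΩ : MeasurableSpace Ω] {μ : Measure Ω} {P : Model 𝒳} {ε : ℝ}
  {γ lam : ℕ → ℝ} {M₁ : ℕ → ℕ} {M₂ M₃ : ℕ} {ℱ : Filtration ℕ mΩ} {p : ℕ → Ω → Fin P.m → ℝ}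
  {X₁ : (k : ℕ) → Fin (M₁ k) → Ω → Fin P.T → Fin P.m} {X₂ : ℕ → Fin M₂ → Ω → Fin P.T → Fin P.m}
  {X₃ : ℕ → Fin M₃ → Ω → Fin P.S → Fin P.m}

theorem IsAltMDSA.mem_restrictedSimplex (hrun : IsAltMDSA P ε γ lam M₁ M₂ M₃ μ ℱ p X₁ X₂ X₃)
    (hε : 0 < ε) (hεm : ε < 1 / (P.m : ℝ)) {k : ℕ} (hk : 1 ≤ k) (ω : Ω) :
    p k ω ∈ restrictedSimplex P.m ε := by
  induction k, hk using Nat.le_induction with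
  | base => exact hrun.init ω
  | succ k hk ih => exact (hrun.update k hk ω).mem_restrictedSimplex hε hεm ih

/-- The drift inequality of the algorithm. -/
theorem IsAltMDSA.exists_condExp_klDivSum_le [IsProbabilityMeasure μ]
    (hrun : IsAltMDSA P ε γ lam M₁ M₂ M₃ μ ℱ p X₁ X₂ X₃) (hε : 0 < ε) (hεm : ε < 1 / (P.m : ℝ))
    (hj : ∀ j, P.lo j ≤ P.hi j) (hM₂ : 1 ≤ M₂) (hM₃ : 1 ≤ M₃) (l₀ : ℝ) :
    ∃ C, 0 ≤ C ∧ ∀ k, 1 ≤ k → |lam k| ≤ l₀ → 0 ≤ γ k → 1 ≤ M₁ k →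
      ∀ q ∈ restrictedSimplex P.m ε, ∀ q' ∈ restrictedSimplex P.m ε,
        μ[fun ω => klDivSum q' (p (k + 1) ω) | ℱ k] ≤ᵐ[μ] fun ω => klDivSum q (p k ω) -
          γ k * ((lam k • P.gradPsi (p k ω) + P.gradPenalty (p k ω)) ⬝ᵥ (p k ω - q)) +
          C * (γ k ^ 2 + γ k / √(M₁ k : ℝ) + ‖q' - q‖) := by
  obtain ⟨B, hB0, hB⟩ := Model.exists_abs_gradHat_le hj hε l₀
  set C₁ : ℝ := P.m * (2 * P.n * (P.T / ε + P.T)) with hC₁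
  set C₂ : ℝ := |1 - 2 * Real.log ε| * P.m with hC₂
  have h₁ : 0 ≤ C₁ := by positivity
  have h₂ : 0 ≤ C₂ := by positivity
  -- The summands pay for the squared step, for the bias of the estimator and for the move of the
  -- target from q to q'.
  refine ⟨P.m * B ^ 2 + C₁ + C₂, by positivity, fun k hk hl hγ hM q hq q' hq' => ?_⟩
  have hp := fun ω => hrun.mem_restrictedSimplex hε hεm hk ω
  have hp' := fun ω => hrun.mem_restrictedSimplex hε hεm (Nat.le_succ_of_le hk) ω
  set Z : Ω → P.Sample (M₁ k) M₂ M₃ := fun ω =>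
    (fun r => X₁ k r ω, fun r => X₂ k r ω, fun r => X₃ k r ω) with hZdef
  -- A pathwise upper bound for the next divergence, written as a function of the sample and the
  -- current iterate so that `condExp_comp_finite` applies.
  set f : P.Sample (M₁ k) M₂ M₃ → (Fin P.m → ℝ) → ℝ := fun x v =>
    klDivSum q v - ∑ i, γ k * P.gradHat (lam k) v x i * (v i - q i) +
      (γ k ^ 2 * (P.m * B ^ 2) + C₂ * ‖q' - q‖) with hf
  have hfc : ∀ x, ContinuousOn (f x) (restrictedSimplex P.m ε) := fun x =>
    ((continuousOn_klDivSum hε q).sub (continuousOn_finsetSum _ fun i _ =>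
      (continuousOn_const.mul (Model.continuousOn_gradHat hε _ x i)).mul
        ((continuous_apply i).continuousOn.sub continuousOn_const))).add continuousOn_const
  obtain ⟨Cf, hCf⟩ : ∃ C, ∀ x, ∀ v ∈ restrictedSimplex P.m ε, |f x v| ≤ C := by
    choose C hC using fun x =>
      (isCompact_restrictedSimplex hε).exists_bound_of_continuousOn (hfc x)
    refine ⟨∑ x, |C x|, fun x v hv => (hC x v hv).trans ((le_abs_self _).trans ?_)⟩
    exact Finset.single_le_sum (f := fun x => |C x|) (fun _ _ => abs_nonneg _) (Finset.mem_univ x)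
  have hset : ∀ x : P.Sample (M₁ k) M₂ M₃, {ω | Z ω = x} =
      {ω | (∀ r, X₁ k r ω = x.1 r) ∧ (∀ r, X₂ k r ω = x.2.1 r) ∧ (∀ r, X₃ k r ω = x.2.2 r)} :=
    fun x => by
      ext ω
      simp only [hZdef, Set.mem_ofPred_eq, Prod.ext_iff, funext_iff]
  have hZm : ∀ x, MeasurableSet {ω | Z ω = x} := fun x => by
    have m1 := fun r => (hrun.meas₁ k hk r).mono (ℱ.le _) le_rfl
    have m2 := fun r => (hrun.meas₂ k hk r).mono (ℱ.le _) le_rfl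
    have m3 := fun r => (hrun.meas₃ k hk r).mono (ℱ.le _) le_rfl
    have : Measurable Z := (measurable_pi_lambda _ m1).prodMk
      ((measurable_pi_lambda _ m2).prodMk (measurable_pi_lambda _ m3))
    exact this (measurableSet_singleton x)
  obtain ⟨hint, hcond⟩ := condExp_comp_finite (μ := μ) (ℱ.le k) hZm
    (π := fun x ω => P.sampleProb (p k ω) x)
    (fun x => by rw [hset x]; exact hrun.sampling k hk x.1 x.2.1 x.2.2)
    (fun x => stronglyMeasurable_comp_simplex (hrun.adapted k hk) hp (hfc x))
    (fun x ω => hCf x _ (hp ω))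
  have hpt : (fun ω => klDivSum q' (p (k + 1) ω)) ≤ fun ω => f (Z ω) (p k ω) := fun ω => by
    have s1 := (hrun.update k hk ω).klDivSum_le hε hεm (hp ω) hq
    have s2 := klDivSum_sub_le hε (hp' ω) hq' hq
    have s3 : ∑ i, (γ k * P.gradHat (lam k) (p k ω) (Z ω) i) ^ 2 ≤ γ k ^ 2 * (P.m * B ^ 2) := by
      have : ∀ i ∈ (Finset.univ : Finset (Fin P.m)),
          (γ k * P.gradHat (lam k) (p k ω) (Z ω) i) ^ 2 ≤ γ k ^ 2 * B ^ 2 := fun i _ => by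
        rw [mul_pow]
        exact mul_le_mul_of_nonneg_left (sq_le_sq' (abs_le.1 (hB _ _ (Z ω) i hl (hp ω))).1
          (abs_le.1 (hB _ _ (Z ω) i hl (hp ω))).2) (sq_nonneg _)
      refine (Finset.sum_le_sum this).trans (le_of_eq ?_)
      simp only [Finset.sum_const, Finset.card_univ, Fintype.card_fin, nsmul_eq_mul]
      ring
    have s4 : (1 - 2 * Real.log ε) * ∑ i, |q' i - q i| ≤ C₂ * ‖q' - q‖ := by
      rw [hC₂, mul_assoc]
      refine mul_le_mul (le_abs_self _) ?_ (Finset.sum_nonneg fun _ _ => abs_nonneg _)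
        (abs_nonneg _)
      refine (Finset.sum_le_sum fun i _ => norm_le_pi_norm (q' - q) i).trans (le_of_eq ?_)
      simp
    have s5 : f (Z ω) (p k ω) = klDivSum q (p k ω) -
      ∑ i, γ k * P.gradHat (lam k) (p k ω) (Z ω) i * (p k ω i - q i) +
      (γ k ^ 2 * (P.m * B ^ 2) + C₂ * ‖q' - q‖) := rfl
    change klDivSum q' (p (k + 1) ω) ≤ f (Z ω) (p k ω)
    rw [s5]
    simp only [Model.gradHat, hZdef] at s3 ⊢
    linarith
  have hmono := condExp_mono (m := ℱ k) (integrable_comp_simplex (μ := μ) hε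
    ((hrun.adapted (k + 1) (by omega)).mono (ℱ.le _) le_rfl) hp' (continuousOn_klDivSum hε q'))
    hint (Eventually.of_forall hpt)
  filter_upwards [hmono, hcond] with ω e1 e2
  refine e1.trans (e2.le.trans ?_)
  set v := p k ω with hv
  have hsum : ∑ x : P.Sample (M₁ k) M₂ M₃, P.sampleProb v x * f x v = klDivSum q v -
      γ k * ∑ i, (∑ x : P.Sample (M₁ k) M₂ M₃, P.sampleProb v x * P.gradHat (lam k) v x i) *
        (v i - q i) + (γ k ^ 2 * (P.m * B ^ 2) + C₂ * ‖q' - q‖) := by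
    have hone : ∑ x : P.Sample (M₁ k) M₂ M₃, P.sampleProb v x = 1 :=
      Model.sum_sampleProb (hp ω).1
    have hlin : ∀ (K c : ℝ) (g : P.Sample (M₁ k) M₂ M₃ → ℝ),
        ∑ x, P.sampleProb v x * (K - g x + c) = K - ∑ x, P.sampleProb v x * g x + c := by
      intro K c g
      simp only [mul_add, mul_sub, Finset.sum_add_distrib, Finset.sum_sub_distrib,
        ← Finset.sum_mul]
      rw [hone, one_mul, one_mul]
    rw [hlin]
    congr 2
    simp only [Finset.mul_sum, Finset.sum_mul]
    rw [Finset.sum_comm]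
    exact Finset.sum_congr rfl fun i _ => Finset.sum_congr rfl fun x _ => by ring
  have hbias : (lam k • P.gradPsi v + P.gradPenalty v) ⬝ᵥ (v - q) -
      ∑ i, (∑ x : P.Sample (M₁ k) M₂ M₃, P.sampleProb v x * P.gradHat (lam k) v x i) *
        (v i - q i) ≤ C₁ * (1 / √(M₁ k : ℝ)) := by
    rw [dotProduct, ← Finset.sum_sub_distrib]
    have : ∀ i ∈ (Finset.univ : Finset (Fin P.m)),
        (lam k • P.gradPsi v + P.gradPenalty v) i * (v - q) i -
          (∑ x : P.Sample (M₁ k) M₂ M₃, P.sampleProb v x * P.gradHat (lam k) v x i) *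
            (v i - q i) ≤ 2 * P.n * (P.T / ε + P.T) * (1 / √(M₁ k : ℝ)) := fun i _ => by
      rw [Pi.sub_apply, ← sub_mul]
      refine (le_abs_self _).trans ?_
      rw [abs_mul, abs_sub_comm]
      have t1 := Model.abs_sum_sampleProb_gradHat_sub_le hj hε (hp ω) hM hM₂ hM₃ (lam k) i
      have t2 : |v i - q i| ≤ 1 := by
        have a1 := restrictedSimplex_pos hε (hp ω) i
        have a2 := restrictedSimplex_le_one hε (hp ω) i
        have a3 := restrictedSimplex_pos hε hq i
        have a4 := restrictedSimplex_le_one hε hq i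
        rw [abs_le]
        constructor <;> linarith
      exact (mul_le_of_le_one_right (abs_nonneg _) t2).trans t1
    refine (Finset.sum_le_sum this).trans (le_of_eq ?_)
    simp only [Finset.sum_const, Finset.card_univ, Fintype.card_fin, nsmul_eq_mul, hC₁]
    ring
  have hγb := mul_le_mul_of_nonneg_left hbias hγ
  rw [hsum]
  have d1 : 0 ≤ γ k / √(M₁ k : ℝ) := by positivity
  have d2 : γ k * (C₁ * (1 / √(M₁ k : ℝ))) = C₁ * (γ k / √(M₁ k : ℝ)) := by ring
  have d3 := norm_nonneg (q' - q)
  have d4 := sq_nonneg (γ k)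
  have d5 : 0 ≤ (P.m : ℝ) * B ^ 2 := by positivity
  rw [d2] at hγb
  nlinarith [mul_nonneg h₁ d3, mul_nonneg h₁ d4, mul_nonneg h₂ d1, mul_nonneg h₂ d4,
    mul_nonneg d5 d1, mul_nonneg d5 d3]

end Run

-- Conditions on step sizes, penalty coefficients and batch sizes.

theorem tendsto_sum_Icc_one_iff {f : ℕ → ℝ} (hf : ∀ k, 1 ≤ k → 0 ≤ f k) :
    Tendsto (fun N : ℕ => ∑ k ∈ Finset.Icc 1 N, f k) atTop atTop ↔ ¬ Summable f := by
  have h : ∀ N, ∑ k ∈ Finset.Icc 1 N, f k = ∑ k ∈ Finset.range N, f (k + 1) := fun N => by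
    rw [← Finset.Ico_add_one_right_eq_Icc, Finset.sum_Ico_eq_sum_range, Nat.add_sub_cancel]
    simp only [add_comm 1]
  simp only [h]
  rw [← summable_nat_add_iff 1, not_summable_iff_tendsto_nat_atTop_of_nonneg]
  exact fun k => hf _ (by omega)

/-- The terms dominate the increments of log log, by log x ≤ x − 1 used twice, and log log is
unbounded. The shift by 2 keeps the inner logarithm positive. -/
theorem not_summable_one_div_mul_log : ¬ Summable fun k : ℕ => 1 / ((k : ℝ) * Real.log k) := by
  intro hs
  have hs' := (summable_nat_add_iff 2).2 hs
  set g : ℕ → ℝ := fun k => Real.log (Real.log ((k + 2 : ℕ) : ℝ)) with hg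
  have hlog : ∀ k : ℕ, 0 < Real.log ((k + 2 : ℕ) : ℝ) := fun k =>
    Real.log_pos (by exact_mod_cast (by omega : 1 < k + 2))
  have hstep : ∀ k, g (k + 1) - g k ≤ 1 / (((k + 2 : ℕ) : ℝ) * Real.log ((k + 2 : ℕ) : ℝ)) := by
    intro k
    have hk : (0 : ℝ) < ((k + 2 : ℕ) : ℝ) := by positivity
    have h0 := hlog k
    have h1 := hlog (k + 1)
    have h2 : g (k + 1) - g k ≤
        Real.log ((k + 1 + 2 : ℕ) : ℝ) / Real.log ((k + 2 : ℕ) : ℝ) - 1 := by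
      rw [hg, ← Real.log_div h1.ne' h0.ne']
      exact Real.log_le_sub_one_of_pos (by positivity)
    have h3 : Real.log ((k + 1 + 2 : ℕ) : ℝ) - Real.log ((k + 2 : ℕ) : ℝ) ≤
        1 / ((k + 2 : ℕ) : ℝ) := by
      rw [← Real.log_div (by positivity) (by positivity)]
      refine (Real.log_le_sub_one_of_pos (by positivity)).trans (le_of_eq ?_)
      push_cast
      field_simp
      ring
    refine h2.trans ?_
    rw [div_sub_one h0.ne', ← div_div]
    gcongr
  have hbound : ∀ n, g n - g 0 ≤ ∑' k : ℕ, 1 / (((k + 2 : ℕ) : ℝ) * Real.log ((k + 2 : ℕ) : ℝ)) :=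
    fun n => by
      rw [← Finset.sum_range_sub]
      refine (Finset.sum_le_sum fun k _ => hstep k).trans (hs'.sum_le_tsum _ fun k _ => ?_)
      have := hlog k
      positivity
  have hgtop : Tendsto g atTop atTop := Real.tendsto_log_atTop.comp <| Real.tendsto_log_atTop.comp <|
    tendsto_natCast_atTop_atTop.comp (tendsto_add_atTop_nat 2)
  obtain ⟨n, hn⟩ := (hgtop.eventually_gt_atTop
    (∑' k : ℕ, 1 / (((k + 2 : ℕ) : ℝ) * Real.log ((k + 2 : ℕ) : ℝ)) + g 0)).exists
  linarith [hbound n]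

/-- The general conditions, with a penalty coefficient that is only eventually non-increasing. -/
def EventualStepCond (γ lam : ℕ → ℝ) (M₁ : ℕ → ℕ) : Prop :=
  ¬ Summable (fun k => γ k * lam k) ∧
  Summable (fun k => γ k ^ 2) ∧
  Summable (fun k => γ k / √(M₁ k : ℝ)) ∧
  Tendsto lam atTop (𝓝 0) ∧
  ∀ᶠ k in atTop, lam (k + 1) ≤ lam k

theorem StepCond.eventualStepCond {γ lam : ℕ → ℝ} {M₁ : ℕ → ℕ} (hγ : ∀ k, 1 ≤ k → 0 < γ k)
    (hlam : ∀ k, 1 ≤ k → 0 < lam k) (h : StepCond γ lam M₁) : EventualStepCond γ lam M₁ :=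
  ⟨(tendsto_sum_Icc_one_iff fun k hk => (mul_pos (hγ k hk) (hlam k hk)).le).1 h.1, h.2.1, h.2.2.1,
    h.2.2.2.1, (eventually_ge_atTop 1).mono h.2.2.2.2⟩

/-- Monotonicity is only eventual because `lam 1` is unrestricted in the logarithmic case. -/
theorem PolyChoice.eventualStepCond {γ lam : ℕ → ℝ} {M₁ : ℕ → ℕ} (h : PolyChoice γ lam M₁) :
    EventualStepCond γ lam M₁ := by
  obtain ⟨a, b, c, α₁, α₂, ha, hb, hc, h1, h1', h2, hγ, hM, hl⟩ := h
  have hα₂ : 0 < α₂ := by linarith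
  have hpow : ∀ {s : ℝ}, 0 < s → Tendsto (fun k : ℕ => (k : ℝ) ^ s) atTop atTop := fun hs =>
    (tendsto_rpow_atTop hs).comp tendsto_natCast_atTop_atTop
  have hsq : Summable fun k => γ k ^ 2 := by
    refine Summable.of_norm_bounded_eventually_nat
      ((Real.summable_one_div_nat_rpow.2 (by linarith : 1 < 2 * α₁)).mul_left (a ^ 2)) ?_
    filter_upwards [eventually_ge_atTop 1] with k hk
    have hk' : (0 : ℝ) < k := by exact_mod_cast hk
    rw [hγ k hk, Real.norm_of_nonneg (by positivity), div_pow, mul_one_div, ← Real.rpow_natCast,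
      ← Real.rpow_natCast ((k : ℝ) ^ α₁), ← Real.rpow_mul hk'.le]
    apply le_of_eq
    push_cast
    rw [mul_comm α₁]
  have hbatch : Summable fun k => γ k / √(M₁ k : ℝ) := by
    refine Summable.of_norm_bounded_eventually_nat
      ((Real.summable_one_div_nat_rpow.2 (by linarith : 1 < α₁ + α₂ / 2)).mul_left
        (a / √(b / 2))) ?_
    filter_upwards [eventually_ge_atTop 1, (hpow hα₂).eventually_ge_atTop (2 / b)] with k hk hkb
    have hk' : (0 : ℝ) < k := by exact_mod_cast hk
    have hMk := (abs_lt.1 (hM k hk)).1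
    rw [div_le_iff₀ hb] at hkb
    -- Once b·k^α₂ ≥ 2, rounding loses less than half of the batch size.
    have hle : b / 2 * (k : ℝ) ^ α₂ ≤ M₁ k := by linarith
    have hsq : √(b / 2) * (k : ℝ) ^ (α₂ / 2) ≤ √(M₁ k : ℝ) := by
      refine Real.le_sqrt_of_sq_le (le_trans (le_of_eq ?_) hle)
      rw [mul_pow, Real.sq_sqrt (by positivity), ← Real.rpow_natCast, ← Real.rpow_mul hk'.le]
      norm_num
    rw [hγ k hk, Real.norm_of_nonneg (by positivity), Real.rpow_add hk']
    calc a / (k : ℝ) ^ α₁ / √(M₁ k : ℝ)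
        ≤ a / (k : ℝ) ^ α₁ / (√(b / 2) * (k : ℝ) ^ (α₂ / 2)) := by gcongr
      _ = _ := by field_simp
  suffices ¬ Summable (fun k => γ k * lam k) ∧ Tendsto lam atTop (𝓝 0) ∧
      ∀ᶠ k in atTop, lam (k + 1) ≤ lam k from ⟨this.1, hsq, hbatch, this.2⟩
  rcases hl with ⟨h3, α₃, h4, h5, hl⟩ | ⟨h3, hl⟩
  · refine ⟨fun hs => ?_, ?_, ?_⟩
    · refine Real.not_summable_one_div_natCast ?_
      refine Summable.of_norm_bounded_eventually_nat (hs.mul_left (1 / (a * c))) ?_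
      filter_upwards [eventually_ge_atTop 1] with k hk
      have hk' : (0 : ℝ) < k := by exact_mod_cast hk
      have hk1 : (1 : ℝ) ≤ k := by exact_mod_cast hk
      have e : 1 / (a * c) * (a / (k : ℝ) ^ α₁ * (c / (k : ℝ) ^ α₃)) =
          1 / (k : ℝ) ^ (α₁ + α₃) := by
        rw [Real.rpow_add hk']; field_simp
      rw [hγ k hk, hl k hk, e, Real.norm_of_nonneg (by positivity)]
      refine one_div_le_one_div_of_le (by positivity) ?_
      calc (k : ℝ) ^ (α₁ + α₃) ≤ (k : ℝ) ^ (1 : ℝ) :=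
            Real.rpow_le_rpow_of_exponent_le hk1 (by linarith)
        _ = k := Real.rpow_one _
    · refine ((hpow h4).const_div_atTop c).congr' ?_
      filter_upwards [eventually_ge_atTop 1] with k hk using (hl k hk).symm
    · filter_upwards [eventually_ge_atTop 1] with k hk
      have hk' : (0 : ℝ) < k := by exact_mod_cast hk
      rw [hl k hk, hl (k + 1) (by omega)]
      gcongr
      exact Nat.le_succ k
  · have hlogtop : Tendsto (fun k : ℕ => Real.log k) atTop atTop :=
      Real.tendsto_log_atTop.comp tendsto_natCast_atTop_atTop
    refine ⟨fun hs => ?_, ?_, ?_⟩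
    · refine not_summable_one_div_mul_log ?_
      refine Summable.of_norm_bounded_eventually_nat (hs.mul_left (1 / (a * c))) ?_
      filter_upwards [eventually_ge_atTop 2] with k hk
      have hk' : (1 : ℝ) < k := by exact_mod_cast hk
      have hlk := Real.log_pos hk'
      rw [hγ k (by omega), hl k hk, h3, Real.rpow_one, Real.norm_of_nonneg (by positivity)]
      apply le_of_eq
      field_simp
    · refine (hlogtop.const_div_atTop c).congr' ?_
      filter_upwards [eventually_ge_atTop 2] with k hk using (hl k hk).symm
    · filter_upwards [eventually_ge_atTop 2] with k hk
      have hk' : (1 : ℝ) < k := by exact_mod_cast hk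
      have hlk := Real.log_pos hk'
      rw [hl k hk, hl (k + 1) (by omega)]
      gcongr
      exact Nat.le_succ k

-- The moving target and almost sure convergence.

theorem summable_norm_sub_of_boundedVariationOn {E : Type*} [NormedAddCommGroup E] {f : ℝ → E}
    {s : Set ℝ} (hf : BoundedVariationOn f s) {u : ℕ → ℝ} (hu : Antitone u) (hus : ∀ n, u n ∈ s) :
    Summable fun n => ‖f (u (n + 1)) - f (u n)‖ := by
  refine summable_of_sum_range_le (c := (eVariationOn f s).toReal) (fun _ => norm_nonneg _)
    fun n => ?_
  -- The reversed order of u is absorbed by composition: f ∘ u is sampled along the identity, and an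
  -- antitone change of parameter does not increase variation.
  have h1 := eVariationOn.sum_le (f := f ∘ u) (s := Set.univ) (n := n) monotone_id
    fun i => Set.mem_univ _
  have h2 := h1.trans (eVariationOn.comp_le_of_antitoneOn f u (hu.antitoneOn _) fun i _ => hus i)
  have h3 := ENNReal.toReal_mono hf h2
  rw [ENNReal.toReal_sum fun i _ => edist_ne_top _ _] at h3
  refine le_trans (le_of_eq (Finset.sum_congr rfl fun i _ => ?_)) h3
  rw [← dist_edist, dist_eq_norm]
  rfl

variable {𝒳 : Type*} {P : Model 𝒳} {ε : ℝ}

/-- The deterministic part of the convergence proof: along one realization, convergence of the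
divergences and summability of the drifts force convergence to `pstar`. -/
theorem tendsto_of_tendsto_klDivSum (hε : 0 < ε) {pstar : Fin P.m → ℝ}
    (hA1 : P.ConstrainedCond ε pstar) {path : ℝ → Fin P.m → ℝ} (hA3 : P.PathRateCond pstar path)
    {γ l : ℕ → ℝ} (hγ : ∀ n, 0 < γ n) (hl : ∀ n, 0 < l n) (hl0 : Tendsto l atTop (𝓝 0))
    (hdiv : ¬ Summable fun n => γ n * l n) (hpath : ∀ n, path (l n) ∈ restrictedSimplex P.m ε)
    {p : ℕ → Fin P.m → ℝ} (hp : ∀ n, p n ∈ restrictedSimplex P.m ε) {d : ℝ}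
    (hd : Tendsto (fun n => klDivSum (path (l n)) (p n)) atTop (𝓝 d))
    (hG : Summable fun n =>
      γ n * ((l n • P.gradPsi (p n) + P.gradPenalty (p n)) ⬝ᵥ (p n - path (l n)))) :
    Tendsto p atTop (𝓝 pstar) := by
  have hl' : Tendsto l atTop (𝓝[>] 0) :=
    tendsto_nhdsWithin_iff.2 ⟨hl0, Eventually.of_forall hl⟩
  have hpath0 : Tendsto (fun n => path (l n) - pstar) atTop (𝓝 0) :=
    (hA3.trans_tendsto (tendsto_id.mono_left nhdsWithin_le_nhds)).comp hl'
  have hd0 : 0 ≤ d := ge_of_tendsto' hd fun n => klDivSum_nonneg hε (hp n) (hpath n)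
  rcases hd0.eq_or_lt with rfl | hdpos
  · have hle : ∀ n, ‖p n - path (l n)‖ ≤ √(4 * klDivSum (path (l n)) (p n)) := fun n => by
      refine (pi_norm_le_iff_of_nonneg (Real.sqrt_nonneg _)).2 fun i => Real.abs_le_sqrt ?_
      have h1 := Finset.single_le_sum (f := fun i => (path (l n) i - p n i) ^ 2 / 4)
        (fun _ _ => by positivity) (Finset.mem_univ i)
      have h2 := h1.trans (klDivSum_ge_sq hε (hp n) (hpath n))
      simp only [Pi.sub_apply] at h2 ⊢
      nlinarith
    have hs : Tendsto (fun n => √(4 * klDivSum (path (l n)) (p n))) atTop (𝓝 0) := by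
      simpa using (hd.const_mul 4).sqrt
    have h1 := squeeze_zero_norm hle hs
    have h2 := (h1.add hpath0).add_const pstar
    simpa using h2
  · exfalso
    set C : ℝ := |1 - 2 * Real.log ε| * P.m + 1 with hC
    have hC0 : 0 < C := by positivity
    have hle : ∀ n, klDivSum (path (l n)) (p n) ≤ C * ‖p n - path (l n)‖ := fun n => by
      refine (klDivSum_le hε (hp n) (hpath n)).trans ?_
      have h1 : ∑ i, |path (l n) i - p n i| ≤ P.m * ‖p n - path (l n)‖ := by
        rw [norm_sub_rev]
        refine (Finset.sum_le_sum fun i _ =>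
          norm_le_pi_norm (path (l n) - p n) i).trans (le_of_eq ?_)
        simp
      have h2 := mul_le_mul (le_abs_self (1 - 2 * Real.log ε)) h1
        (Finset.sum_nonneg fun _ _ => abs_nonneg _) (abs_nonneg _)
      have h3 := norm_nonneg (p n - path (l n))
      rw [hC]
      nlinarith
    -- A divergence above d/2 forces ‖p − path‖ ≥ d/(2C) = 2δ; half of it is given up when `path` is
    -- replaced by `pstar`.
    set δ := d / 2 / C / 2 with hδ
    have hδ0 : 0 < δ := by positivity
    obtain ⟨c, hc, hdrift⟩ := exists_drift_ge hε hA1 hA3 hδ0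
    refine hdiv (Summable.of_norm_bounded_eventually_nat (hG.mul_left (1 / c)) ?_)
    have hnear : ∀ᶠ n in atTop, ‖path (l n) - pstar‖ < δ := by
      simpa using hpath0.norm.eventually (gt_mem_nhds (by simpa using hδ0))
    filter_upwards [hl'.eventually hdrift, hd.eventually (lt_mem_nhds (half_lt_self hdpos)),
      hnear] with n h1 h2 h3
    have h4 : 2 * δ ≤ ‖p n - path (l n)‖ := by
      have := h2.le.trans (hle n)
      rw [hδ, mul_div_cancel₀ _ two_ne_zero, div_le_iff₀' hC0]
      exact this
    have h5 : δ ≤ ‖p n - pstar‖ := by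
      have : p n - path (l n) = (p n - pstar) - (path (l n) - pstar) := by abel
      have h6 := norm_sub_le (p n - pstar) (path (l n) - pstar)
      rw [← this] at h6
      linarith
    have h7 := mul_le_mul_of_nonneg_left (h1 _ (hp n) h5) (hγ n).le
    rw [Real.norm_of_nonneg (mul_pos (hγ n) (hl n)).le, one_div, ← div_eq_inv_mul, le_div_iff₀ hc]
    linarith

theorem IsAltMDSA.ae_tendsto {Ω : Type*} [mΩ : MeasurableSpace Ω] {μ : Measure Ω}
    [IsProbabilityMeasure μ] (hε : 0 < ε) (hεm : ε < 1 / (P.m : ℝ))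
    {pstar : Fin P.m → ℝ} (hA1 : P.ConstrainedCond ε pstar)
    {lamε : ℝ} {path : ℝ → Fin P.m → ℝ} (hA2 : P.PenalizedCond ε lamε path)
    (hA3 : P.PathRateCond pstar path)
    {γ lam : ℕ → ℝ} (hγ : ∀ k, 1 ≤ k → 0 < γ k) (hlam : ∀ k, 1 ≤ k → 0 < lam k)
    {M₁ : ℕ → ℕ} (hM₁ : ∀ k, 1 ≤ k → 1 ≤ M₁ k) {M₂ M₃ : ℕ} (hM₂ : 1 ≤ M₂) (hM₃ : 1 ≤ M₃)
    {ℱ : Filtration ℕ mΩ} {p : ℕ → Ω → Fin P.m → ℝ}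
    {X₁ : (k : ℕ) → Fin (M₁ k) → Ω → Fin P.T → Fin P.m}
    {X₂ : ℕ → Fin M₂ → Ω → Fin P.T → Fin P.m}
    {X₃ : ℕ → Fin M₃ → Ω → Fin P.S → Fin P.m}
    (hrun : IsAltMDSA P ε γ lam M₁ M₂ M₃ μ ℱ p X₁ X₂ X₃) (hstep : EventualStepCond γ lam M₁) :
    ∀ᵐ ω ∂μ, Tendsto (fun k => p k ω) atTop (𝓝 pstar) := by
  obtain ⟨hdiv, hsq, hbatch, hlam0, hanti⟩ := hstep
  obtain ⟨hlamε, hA2, hBV⟩ := hA2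
  have hj := hA1.lo_le_hi
  -- The argument starts at K, beyond which the coefficients are non-increasing and at most `lamε`,
  -- so the path and its gradient condition are available; limits ignore the initial segment.
  obtain ⟨K, hK⟩ := eventually_atTop.1 (((eventually_ge_atTop 1).and hanti).and
    (hlam0.eventually (ge_mem_nhds hlamε)))
  have hK1 : ∀ n, 1 ≤ n + K := fun n => (hK (n + K) (by omega)).1.1
  set l : ℕ → ℝ := fun n => lam (n + K) with hl
  have hlmem : ∀ n, l n ∈ Set.Ioc 0 lamε := fun n =>
    ⟨hlam _ (hK1 n), (hK (n + K) (by omega)).2⟩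
  have hlanti : Antitone l := antitone_nat_of_succ_le fun n => by
    have := (hK (n + K) (by omega)).1.2
    simpa [hl, add_right_comm] using this
  set q : ℕ → Fin P.m → ℝ := fun n => path (l n) with hq
  have hqmem : ∀ n, q n ∈ restrictedSimplex P.m ε := fun n => (hA2 _ (hlmem n)).1.1
  have hpmem : ∀ n ω, p (n + K) ω ∈ restrictedSimplex P.m ε := fun n ω =>
    hrun.mem_restrictedSimplex hε hεm (hK1 n) ω
  obtain ⟨C, hC0, hC⟩ := hrun.exists_condExp_klDivSum_le hε hεm hj hM₂ hM₃ lamε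
  let 𝒢 : Filtration ℕ mΩ :=
    ⟨fun n => ℱ (n + K), fun _ _ hij => ℱ.mono (Nat.add_le_add_right hij K), fun n => ℱ.le _⟩
  set D : ℕ → Ω → ℝ := fun n ω => klDivSum (q n) (p (n + K) ω) with hD
  set g : ℕ → (Fin P.m → ℝ) → ℝ := fun n v =>
    γ (n + K) * ((l n • P.gradPsi v + P.gradPenalty v) ⬝ᵥ (v - q n)) with hg
  have hgc : ∀ n, ContinuousOn (g n) (restrictedSimplex P.m ε) := fun n => by
    refine continuousOn_const.mul (continuousOn_finsetSum _ fun i _ => ContinuousOn.mul ?_ ?_)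
    · exact (continuousOn_const.mul ((continuous_apply i).comp_continuousOn
        (P.continuousOn_gradPsi hε))).add ((continuous_apply i).comp_continuousOn
        (Model.continuousOn_gradPenalty hj hε))
    · exact (continuous_apply i).continuousOn.sub continuousOn_const
  have hpm : ∀ n, Measurable[𝒢 n] (p (n + K)) := fun n => hrun.adapted _ (hK1 n)
  have hpm' : ∀ n, Measurable (p (n + K)) := fun n => (hpm n).mono (𝒢.le n) le_rfl
  have hrs := ae_tendsto_and_summable_of_condExp_le (μ := μ) (ℱ := 𝒢) (D := D)
    (G := fun n ω => g n (p (n + K) ω))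
    (r := fun n => C * (γ (n + K) ^ 2 + γ (n + K) / √(M₁ (n + K) : ℝ) + ‖q (n + 1) - q n‖))
    (fun n => stronglyMeasurable_comp_simplex (hpm n) (hpmem n) (continuousOn_klDivSum hε (q n)))
    (fun n => stronglyMeasurable_comp_simplex (hpm n) (hpmem n) (hgc n))
    (fun n => integrable_comp_simplex hε (hpm' n) (hpmem n) (continuousOn_klDivSum hε (q n)))
    (fun n => integrable_comp_simplex hε (hpm' n) (hpmem n) (hgc n))
    (fun n ω => klDivSum_nonneg hε (hpmem n ω) (hqmem n))
    (fun n ω => mul_nonneg (hγ _ (hK1 n)).le ((hA2 _ (hlmem n)).2 _ (hpmem n ω)))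
    (fun n => by have := (hγ _ (hK1 n)).le; positivity)
    (((((summable_nat_add_iff K).2 hsq).add ((summable_nat_add_iff K).2 hbatch)).add
      (summable_norm_sub_of_boundedVariationOn hBV hlanti hlmem)).mul_left C)
    (fun n => by
      have := hC (n + K) (hK1 n) (by rw [abs_of_pos (hlmem n).1]; exact (hlmem n).2)
        (hγ _ (hK1 n)).le (hM₁ _ (hK1 n)) (q n) (hqmem n) (q (n + 1)) (hqmem (n + 1))
      rw [add_right_comm n K 1] at this
      exact this)
  filter_upwards [hrs] with ω ⟨⟨d, hd⟩, hsum⟩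
  rw [← tendsto_add_atTop_iff_nat K]
  exact tendsto_of_tendsto_klDivSum hε hA1 hA3 (fun n => hγ _ (hK1 n)) (fun n => (hlmem n).1)
    ((tendsto_add_atTop_iff_nat K).2 hlam0) (fun h => hdiv ((summable_nat_add_iff K).1 h)) hqmem
    (fun n => hpmem n ω) hd hsum

end SimCalib

theorem mainTheorem10 {𝒳 Ω : Type*} [mΩ : MeasurableSpace Ω] (μ : Measure Ω)
    [IsProbabilityMeasure μ] (P : SimCalib.Model 𝒳) (ε : ℝ) (hε : 0 < ε) (hεm : ε < 1 / (P.m : ℝ))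
    (pstar : Fin P.m → ℝ) (hA1 : P.ConstrainedCond ε pstar)
    (lamε : ℝ) (path : ℝ → Fin P.m → ℝ) (hA2 : P.PenalizedCond ε lamε path)
    (hA3 : P.PathRateCond pstar path)
    (γ lam : ℕ → ℝ) (hγ : ∀ k, 1 ≤ k → 0 < γ k) (hlam : ∀ k, 1 ≤ k → 0 < lam k)
    (M₁ : ℕ → ℕ) (hM₁ : ∀ k, 1 ≤ k → 1 ≤ M₁ k) (M₂ M₃ : ℕ) (hM₂ : 1 ≤ M₂) (hM₃ : 1 ≤ M₃)
    (ℱ : Filtration ℕ mΩ) (p : ℕ → Ω → Fin P.m → ℝ)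
    (X₁ : (k : ℕ) → Fin (M₁ k) → Ω → Fin P.T → Fin P.m)
    (X₂ : ℕ → Fin M₂ → Ω → Fin P.T → Fin P.m)
    (X₃ : ℕ → Fin M₃ → Ω → Fin P.S → Fin P.m)
    (hrun : SimCalib.IsAltMDSA P ε γ lam M₁ M₂ M₃ μ ℱ p X₁ X₂ X₃) :
    (SimCalib.StepCond γ lam M₁ →
      ∀ᵐ ω ∂μ, Tendsto (fun k => p k ω) atTop (𝓝 pstar)) ∧
    (SimCalib.PolyChoice γ lam M₁ →
      ∀ᵐ ω ∂μ, Tendsto (fun k => p k ω) atTop (𝓝 pstar)) :=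
  ⟨fun h => hrun.ae_tendsto hε hεm hA1 hA2 hA3 hγ hlam hM₁ hM₂ hM₃ (h.eventualStepCond hγ hlam),
    fun h => hrun.ae_tendsto hε hεm hA1 hA2 hA3 hγ hlam hM₁ hM₂ hM₃ h.eventualStepCond⟩
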